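/- For every $\varepsilon > 0$ there is a constant $C > 0$, depending only on $\varepsilon$, such that for every real $x \ge 1$ and every integer $q$ with $1 \le q \le x$, $$\frac{1}{\varphi(q)} \sum_{\chi \neq \chi_0} \left| \sum_{n \le x} |\mu(n)|\, \chi(n) \right|^2 \le C\, x^{\varepsilon} \left( x^{1/2} q^{1/2} + \frac{x}{q^{1/2}} \right).$$ Here the outer sum is over all non-trivial Dirichlet characters $\chi$ modulo $q$, that is, all except the principal character $\chi_0$; the inner sum is over the positive integers $n \le x$; $\mu$ is the Möbius function (so $|\mu|$ is the indicator function of the squarefree integers), and $\varphi$ is Euler's totient function. -/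

import Mathlib

open scoped BigOperators

/-! ### The divisor bound -/

/-- The divisor function is bounded by any positive power, up to a constant. -/
theorem card_divisors_le_rpow (ε : ℝ) (hε : 0 < ε) :
    ∃ C : ℝ, 0 < C ∧ ∀ n : ℕ, n ≠ 0 → (n.divisors.card : ℝ) ≤ C * (n : ℝ) ^ ε := by
  -- For p ≥ 2^(1/ε) one has v + 1 ≤ 2^v ≤ p^(εv) with no loss; each of the fewer than P smaller
  -- primes costs at most a factor 1/c.
  obtain ⟨P, hP⟩ := exists_nat_ge ((2 : ℝ) ^ (1 / ε))
  have hlog : 0 < Real.log 2 := Real.log_pos (by norm_num)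
  set c : ℝ := min 1 (ε * Real.log 2) with hc
  have hc0 : 0 < c := lt_min one_pos (mul_pos hε hlog)
  have hc1 : 1 ≤ c⁻¹ := (one_le_inv₀ hc0).2 (min_le_left _ _)
  refine ⟨c⁻¹ ^ P, by positivity, fun n hn => ?_⟩
  have hfac : ∀ p ∈ n.primeFactors, ((n.factorization p + 1 : ℕ) : ℝ) ≤
      (if p < P then c⁻¹ else 1) * ((p : ℝ) ^ n.factorization p) ^ ε := by
    intro p hp
    have hp2 : (2 : ℝ) ≤ p := by exact_mod_cast (Nat.prime_of_mem_primeFactors hp).two_le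
    set v := n.factorization p
    have hpow : ((p : ℝ) ^ v) ^ ε = ((p : ℝ) ^ ε) ^ v := by
      rw [← Real.rpow_natCast, ← Real.rpow_natCast, ← Real.rpow_mul (by positivity),
        ← Real.rpow_mul (by positivity), mul_comm]
    rw [hpow]
    push_cast
    split_ifs with h
    · have h1 : c * (v + 1) ≤ 1 + v * (ε * Real.log 2) := by
        have h2 : c ≤ 1 := min_le_left _ _
        have h3 : c ≤ ε * Real.log 2 := min_le_right _ _
        have : (0 : ℝ) ≤ v := by positivity
        nlinarith
      have h4 : 1 + v * (ε * Real.log 2) ≤ ((2 : ℝ) ^ ε) ^ v := by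
        have := Real.add_one_le_exp (v * (ε * Real.log 2))
        rw [Real.rpow_def_of_pos (by norm_num : (0 : ℝ) < 2), ← Real.exp_nat_mul]
        rw [mul_comm (Real.log 2)]
        linarith
      have h5 : ((2 : ℝ) ^ ε) ^ v ≤ ((p : ℝ) ^ ε) ^ v := by gcongr
      rw [inv_mul_eq_div, le_div_iff₀ hc0]
      linarith
    · have hPp : (2 : ℝ) ^ (1 / ε) ≤ p := hP.trans (by exact_mod_cast not_lt.1 h)
      have h2 : (2 : ℝ) ≤ (p : ℝ) ^ ε := by
        calc (2 : ℝ) = ((2 : ℝ) ^ (1 / ε)) ^ ε := by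
              rw [← Real.rpow_mul (by norm_num), one_div_mul_cancel hε.ne', Real.rpow_one]
          _ ≤ _ := by gcongr
      have h3 : (v : ℝ) + 1 ≤ 2 ^ v := by exact_mod_cast Nat.lt_two_pow_self
      rw [one_mul]
      exact h3.trans (by gcongr)
  rw [Nat.card_divisors hn, Nat.cast_prod]
  calc ∏ p ∈ n.primeFactors, ((n.factorization p + 1 : ℕ) : ℝ)
      ≤ ∏ p ∈ n.primeFactors, (if p < P then c⁻¹ else 1) * ((p : ℝ) ^ n.factorization p) ^ ε :=
        Finset.prod_le_prod (fun _ _ => by positivity) hfac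
    _ = (∏ p ∈ n.primeFactors, if p < P then c⁻¹ else 1) *
          (∏ p ∈ n.primeFactors, ((p : ℝ) ^ n.factorization p)) ^ ε := by
        rw [Finset.prod_mul_distrib, Real.finsetProd_rpow _ _ (fun _ _ => by positivity)]
    _ ≤ c⁻¹ ^ P * (n : ℝ) ^ ε := by
        have h1 : ∏ p ∈ n.primeFactors, ((p : ℝ) ^ n.factorization p) = n := by
          have := Nat.prod_factorization_pow_eq_self hn
          rw [Finsupp.prod, Nat.support_factorization] at this
          exact_mod_cast congrArg (Nat.cast (R := ℝ)) this
        rw [h1]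
        gcongr
        rw [Finset.prod_ite, Finset.prod_const, Finset.prod_const_one, mul_one]
        refine pow_le_pow_right₀ hc1 ?_
        calc _ ≤ (Finset.range P).card := Finset.card_le_card (fun p hp => by
              simp only [Finset.mem_filter] at hp
              simpa using hp.2)
          _ = P := Finset.card_range P

/-! ### Lattice points and the shortest vector -/

/-- The nonzero points of sup norm at most `Y` on the lattice `v ≡ c * u (mod q)`. -/
noncomputable def residuePairs {q : ℕ} (c : ZMod q) (Y : ℕ) : Finset (ℤ × ℤ) :=
  ((Finset.Icc (-(Y : ℤ)) Y) ×ˢ (Finset.Icc (-(Y : ℤ)) Y)).filter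
    (fun p => p ≠ 0 ∧ (p.2 : ZMod q) = c * (p.1 : ZMod q))

theorem mem_residuePairs {q : ℕ} {c : ZMod q} {Y : ℕ} {p : ℤ × ℤ} :
    p ∈ residuePairs c Y ↔ |p.1| ≤ Y ∧ |p.2| ≤ Y ∧ p ≠ 0 ∧ (p.2 : ZMod q) = c * (p.1 : ZMod q) := by
  simp [residuePairs, abs_le, and_assoc]

theorem residuePairs_self_nonempty {q : ℕ} [NeZero q] (c : ZMod q) :
    (residuePairs c q).Nonempty := by
  refine ⟨(0, q), mem_residuePairs.2 ⟨by simp, by simp, ?_, by simp⟩⟩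
  simp [NeZero.ne q]

/-- The least sup norm of a nonzero point on the lattice `v ≡ c * u (mod q)`. -/
noncomputable def latticeMin {q : ℕ} [NeZero q] (c : ZMod q) : ℕ :=
  sInf {l | (residuePairs c l).Nonempty}

section
variable {q : ℕ} [NeZero q]

theorem residuePairs_latticeMin_nonempty (c : ZMod q) :
    (residuePairs c (latticeMin c)).Nonempty :=
  Nat.sInf_mem (s := {l | (residuePairs c l).Nonempty}) ⟨q, residuePairs_self_nonempty c⟩

theorem latticeMin_le_modulus (c : ZMod q) : latticeMin c ≤ q :=
  Nat.sInf_le (residuePairs_self_nonempty c)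

theorem latticeMin_le {c : ZMod q} {p : ℤ × ℤ} (hp : p ≠ 0)
    (h : (p.2 : ZMod q) = c * (p.1 : ZMod q)) {l : ℕ} (h1 : |p.1| ≤ l) (h2 : |p.2| ≤ l) :
    latticeMin c ≤ l :=
  Nat.sInf_le ⟨p, mem_residuePairs.2 ⟨h1, h2, hp, h⟩⟩

theorem latticeMin_pos (c : ZMod q) : 0 < latticeMin c := by
  obtain ⟨p, hp⟩ := residuePairs_latticeMin_nonempty c
  rw [mem_residuePairs] at hp
  obtain ⟨h1, h2, h3, -⟩ := hp
  by_contra h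
  have h0 : latticeMin c = 0 := by omega
  rw [h0] at h1 h2
  exact h3 (Prod.ext (abs_nonpos_iff.1 (by simpa using h1)) (abs_nonpos_iff.1 (by simpa using h2)))

/-- A shortest vector attains the minimum in one of its coordinates. -/
theorem exists_shortest (c : ZMod q) : ∃ p : ℤ × ℤ, (p.2 : ZMod q) = c * (p.1 : ZMod q) ∧
    (|p.1| = latticeMin c ∧ |p.2| ≤ latticeMin c ∨ |p.2| = latticeMin c ∧ |p.1| ≤ latticeMin c) := by
  obtain ⟨p, hp⟩ := residuePairs_latticeMin_nonempty c
  rw [mem_residuePairs] at hp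
  obtain ⟨h1, h2, h3, h4⟩ := hp
  refine ⟨p, h4, ?_⟩
  have h5 : latticeMin c ≤ max p.1.natAbs p.2.natAbs :=
    latticeMin_le h3 h4 (by rw [Int.abs_eq_natAbs]; omega) (by rw [Int.abs_eq_natAbs]; omega)
  rw [Int.abs_eq_natAbs] at h1 h2 ⊢
  rw [Int.abs_eq_natAbs]
  omega
end

/-- Counting points of a separated planar set on equally spaced lines. -/
theorem card_le_of_separated (S : Finset (ℤ × ℤ)) (q Y l : ℕ) (hq : 0 < q) (hl : 0 < l)
    (hlY : l ≤ Y) (u v : ℤ) (hu : |u| = l) (hv : |v| ≤ l)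
    (hS : ∀ p ∈ S, |p.1| ≤ Y ∧ |p.2| ≤ Y)
    (hsep : ∀ p ∈ S, ∀ p' ∈ S, |p.1 - p'.1| < l → |p.2 - p'.2| < l → p = p')
    (hdet : ∀ p ∈ S, (q : ℤ) ∣ p.1 * v - p.2 * u) :
    (S.card : ℝ) ≤ 16 * (Y : ℝ) ^ 2 / q + 4 * Y / l := by
  have hq' : (0 : ℤ) < q := by exact_mod_cast hq
  have hl' : (0 : ℤ) < l := by exact_mod_cast hl
  set J : ℕ := 2 * Y * l / q
  set R : ℕ := Y / l
  have hcard : S.card ≤ ((Finset.Icc (-(J : ℤ)) J) ×ˢ (Finset.Icc (-(R : ℤ) - 1) R)).card := by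
    -- The determinant against the short vector (u, v) is a multiple of q and selects one of at most
    -- 2J + 1 parallel lines; the floor of p.1 / l gives the position on that line. Floors of
    -- negative numbers force the lower end -R - 1.
    refine Finset.card_le_card_of_injOn (fun p => ((p.1 * v - p.2 * u) / q, p.1 / l)) ?_ ?_
    · intro p hp
      obtain ⟨h1, h2⟩ := hS p hp
      obtain ⟨j, hj⟩ := hdet p hp
      have hb : |p.1 * v - p.2 * u| ≤ 2 * Y * l := by
        calc |p.1 * v - p.2 * u| ≤ |p.1 * v| + |p.2 * u| := abs_sub _ _
          _ = |p.1| * |v| + |p.2| * |u| := by rw [abs_mul, abs_mul]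
          _ ≤ Y * l + Y * l := by rw [hu]; gcongr
          _ = _ := by ring
      have hjJ : |j| ≤ J := by
        have h3 : (q : ℤ) * |j| ≤ 2 * Y * l := by
          rw [hj, abs_mul, abs_of_pos hq'] at hb; exact hb
        have h4 : (J : ℤ) = 2 * Y * l / q := by simp [J]
        rw [h4]
        exact (Int.le_ediv_iff_mul_le hq').2 (by linarith)
      have hR : (R : ℤ) = Y / l := by simp [R]
      have h5 : p.1 / l ≤ R := by rw [hR]; exact Int.ediv_le_ediv hl' (abs_le.1 h1).2
      have h6 : -(R : ℤ) - 1 ≤ p.1 / l := by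
        rw [Int.le_ediv_iff_mul_le hl', hR]
        have := Int.lt_ediv_add_one_mul_self (Y : ℤ) hl'
        have := (abs_le.1 h1).1
        linarith
      simp only [Finset.coe_product, Finset.coe_Icc, Set.mem_prod, Set.mem_Icc]
      rw [hj, Int.mul_ediv_cancel_left _ hq'.ne']
      exact ⟨abs_le.1 hjJ, h6, h5⟩
    · intro p hp p' hp' heq
      simp only [Prod.mk.injEq] at heq
      obtain ⟨he1, he2⟩ := heq
      have hd : p.1 * v - p.2 * u = p'.1 * v - p'.2 * u :=
        Int.ediv_left_inj (hdet p hp) (hdet p' hp') |>.1 he1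
      have h1 : |p.1 - p'.1| < l := by
        have a1 := Int.emod_add_mul_ediv p.1 l
        have a2 := Int.emod_add_mul_ediv p'.1 l
        have b1 := Int.emod_nonneg p.1 hl'.ne'
        have b2 := Int.emod_nonneg p'.1 hl'.ne'
        have c1 := Int.emod_lt_of_pos p.1 hl'
        have c2 := Int.emod_lt_of_pos p'.1 hl'
        rw [he2] at a1
        rw [abs_lt]
        constructor <;> linarith
      refine hsep p hp p' hp' h1 ?_
      -- On a common line the difference is parallel to (u, v). As |v| ≤ |u|, the second coordinate
      -- moves no more than the first, so closeness in the first coordinate suffices.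
      have h2 : (p.1 - p'.1) * v = (p.2 - p'.2) * u := by linarith
      have h3 : |p.1 - p'.1| * |v| = |p.2 - p'.2| * l := by
        rw [← abs_mul, h2, abs_mul, hu]
      have h4 : |p.2 - p'.2| * l ≤ |p.1 - p'.1| * l := by rw [← h3]; gcongr
      exact (le_of_mul_le_mul_right h4 hl').trans_lt h1
  have hcard2 : S.card ≤ (2 * J + 1) * (2 * R + 2) := by
    refine hcard.trans (le_of_eq ?_)
    rw [Finset.card_product, Int.card_Icc, Int.card_Icc]
    congr 1 <;> omega
  have hJ : (J : ℝ) ≤ 2 * Y * l / q := by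
    have := @Nat.cast_div_le ℝ _ _ _ (2 * Y * l) q
    push_cast at this; exact this
  have hR : (R : ℝ) ≤ Y / l := Nat.cast_div_le
  have hY1 : (1 : ℝ) ≤ Y / l := by
    rw [one_le_div (by positivity)]; exact_mod_cast hlY
  have hl0 : (l : ℝ) ≠ 0 := by positivity
  have hq0 : (q : ℝ) ≠ 0 := by positivity
  calc (S.card : ℝ) ≤ (2 * J + 1) * (2 * R + 2) := by exact_mod_cast hcard2
    _ ≤ (2 * (2 * Y * l / q) + 1) * (4 * (Y / l)) := by gcongr; linarith
    _ = _ := by field_simp; ring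

theorem card_residuePairs_eq_zero {q : ℕ} [NeZero q] {c : ZMod q} {Y : ℕ} (h : Y < latticeMin c) :
    (residuePairs c Y).card = 0 := by
  rw [Finset.card_eq_zero, Finset.eq_empty_iff_forall_notMem]
  intro p hp
  rw [mem_residuePairs] at hp
  exact absurd (latticeMin_le hp.2.2.1 hp.2.2.2 hp.1 hp.2.1) (by omega)

/-- Two lattice points differ by a lattice vector, so minimality separates them by `latticeMin c` in
sup norm, and the determinant of two lattice vectors is divisible by q. If the shortest vector
attains its norm in the second coordinate, the axes are swapped. -/
theorem card_residuePairs_le {q : ℕ} [NeZero q] {c : ZMod q} {Y : ℕ} (h : latticeMin c ≤ Y) :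
    ((residuePairs c Y).card : ℝ) ≤ 16 * (Y : ℝ) ^ 2 / q + 4 * Y / latticeMin c := by
  have hq : 0 < q := Nat.pos_of_ne_zero (NeZero.ne q)
  have hsep : ∀ p ∈ residuePairs c Y, ∀ p' ∈ residuePairs c Y,
      |p.1 - p'.1| < latticeMin c → |p.2 - p'.2| < latticeMin c → p = p' := by
    intro p hp p' hp' h1 h2
    rw [mem_residuePairs] at hp hp'
    by_contra hne
    have := latticeMin_le (c := c) (p := p - p') (sub_ne_zero.2 hne)
      (by simp only [Prod.snd_sub, Prod.fst_sub]; push_cast; rw [hp.2.2.2, hp'.2.2.2]; ring)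
      (l := latticeMin c - 1) (by simp only [Prod.fst_sub]; omega)
      (by simp only [Prod.snd_sub]; omega)
    have := latticeMin_pos c
    omega
  obtain ⟨p0, hp0, hmin⟩ := exists_shortest c
  have hdet : ∀ p ∈ residuePairs c Y, (q : ℤ) ∣ p.1 * p0.2 - p.2 * p0.1 := by
    intro p hp
    rw [mem_residuePairs] at hp
    rw [← ZMod.intCast_zmod_eq_zero_iff_dvd]
    push_cast
    rw [hp0, hp.2.2.2]; ring
  rcases hmin with hmin | hmin
  · exact card_le_of_separated _ q Y _ hq (latticeMin_pos c) h p0.1 p0.2 hmin.1 hmin.2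
      (fun p hp => ⟨(mem_residuePairs.1 hp).1, (mem_residuePairs.1 hp).2.1⟩) hsep hdet
  · rw [← Finset.card_map (Equiv.prodComm ℤ ℤ).toEmbedding]
    refine card_le_of_separated _ q Y _ hq (latticeMin_pos c) h p0.2 p0.1 hmin.1 hmin.2 ?_ ?_ ?_
    · intro p hp
      obtain ⟨p', hp', rfl⟩ := Finset.mem_map.1 hp
      exact ⟨(mem_residuePairs.1 hp').2.1, (mem_residuePairs.1 hp').1⟩
    · intro p hp r hr h1 h2
      obtain ⟨p', hp', rfl⟩ := Finset.mem_map.1 hp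
      obtain ⟨r', hr', rfl⟩ := Finset.mem_map.1 hr
      exact congrArg _ (hsep p' hp' r' hr' h2 h1)
    · intro p hp
      obtain ⟨p', hp', rfl⟩ := Finset.mem_map.1 hp
      have := (hdet p' hp').neg_right
      rwa [neg_sub] at this

/-! ### Units with a given minimum, and square roots modulo `q` -/

open scoped Classical in
/-- Few residue classes `c` bring `l` into `[-l, l]` upon multiplication. -/
theorem card_mul_small_le {q : ℕ} [NeZero q] (l : ℕ) (hl : 0 < l) :
    (Finset.univ.filter (fun c : ZMod q => ∃ v : ℤ, |v| ≤ l ∧ c * (l : ZMod q) = v)).card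
      ≤ 6 * l := by
  have hq : 0 < q := Nat.pos_of_ne_zero (NeZero.ne q)
  rcases le_or_gt q l with hql | hlq
  · refine (Finset.card_le_univ _).trans ?_
    rw [ZMod.card]; omega
  -- Lift to integers: c·l = v + qj with |v| ≤ l forces 0 ≤ j ≤ l (the lower bound uses l < q), and
  -- c then differs from ⌊qj/l⌋ by at most 1. This leaves 3(l + 1) ≤ 6l candidates.
  have hsub : (Finset.univ.filter (fun c : ZMod q => ∃ v : ℤ, |v| ≤ l ∧ c * (l : ZMod q) = v)) ⊆
      ((Finset.Icc (0 : ℤ) l) ×ˢ (Finset.Icc (-1 : ℤ) 1)).image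
        (fun p => (((q : ℤ) * p.1 / l + p.2 : ℤ) : ZMod q)) := by
    intro c hc
    obtain ⟨v, hv, hcv⟩ := (Finset.mem_filter.1 hc).2
    have hc0 : ((c.val : ℤ) : ZMod q) = c := by simp
    have hdvd : (q : ℤ) ∣ c.val * l - v := by
      rw [← ZMod.intCast_zmod_eq_zero_iff_dvd]
      push_cast
      rw [← hcv]; simp
    obtain ⟨j, hj⟩ := hdvd
    have hvl := ZMod.val_lt c
    have hl' : (0 : ℤ) < l := by exact_mod_cast hl
    have hq' : (0 : ℤ) < q := by exact_mod_cast hq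
    have hvl' : (c.val : ℤ) ≤ q - 1 := by omega
    obtain ⟨hv1, hv2⟩ := abs_le.1 hv
    have hj0 : 0 ≤ j := by
      by_contra hneg
      have : (q : ℤ) * j ≤ q * (-1) := by gcongr; omega
      have : (0 : ℤ) ≤ c.val * l := by positivity
      omega
    have hjl : j ≤ l := by
      have h1 : (c.val : ℤ) * l ≤ (q - 1) * l := by gcongr
      have h2 : (q : ℤ) * j ≤ q * l := by linarith
      exact le_of_mul_le_mul_left h2 hq'
    have e1 := Int.emod_add_mul_ediv ((q : ℤ) * j) l
    have e2 := Int.emod_nonneg ((q : ℤ) * j) hl'.ne'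
    have e3 := Int.emod_lt_of_pos ((q : ℤ) * j) hl'
    set t := (q : ℤ) * j / l
    refine Finset.mem_image.2 ⟨(j, c.val - t), ?_, ?_⟩
    · simp only [Finset.mem_product, Finset.mem_Icc]
      refine ⟨⟨hj0, hjl⟩, ?_, ?_⟩
      · have : (-2 : ℤ) * l < (c.val - t) * l := by linarith
        have := lt_of_mul_lt_mul_right this hl'.le
        omega
      · have : ((c.val : ℤ) - t) * l < 2 * l := by linarith
        have := lt_of_mul_lt_mul_right this hl'.le
        omega
    · show ((t + (c.val - t) : ℤ) : ZMod q) = c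
      rw [add_sub_cancel, hc0]
  refine (Finset.card_le_card hsub).trans (Finset.card_image_le.trans ?_)
  rw [Finset.card_product, Int.card_Icc, Int.card_Icc,
    show ((l : ℤ) + 1 - 0).toNat = l + 1 by omega, show ((1 : ℤ) + 1 - -1).toNat = 3 from rfl]
  omega

/-- A shortest vector has a coordinate ±l. If it is the first, c maps l into [-l, l]; if the second,
c⁻¹ does. Each case allows at most 6l units. -/
theorem card_latticeMin_eq_le {q : ℕ} [NeZero q] (l : ℕ) (hl : 0 < l) :
    (Finset.univ.filter (fun c : (ZMod q)ˣ => latticeMin (c : ZMod q) = l)).card ≤ 12 * l := by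
  classical
  set A := Finset.univ.filter (fun c : ZMod q => ∃ v : ℤ, |v| ≤ l ∧ c * (l : ZMod q) = v)
  have key : ∀ (c : ZMod q) (u v : ℤ), |u| = l → |v| ≤ l → c * (u : ZMod q) = v → c ∈ A := by
    intro c u v hu hv h
    rw [Finset.mem_filter]
    refine ⟨Finset.mem_univ _, ?_⟩
    rcases (abs_eq (by positivity : (0 : ℤ) ≤ l)).1 hu with rfl | rfl
    · exact ⟨v, hv, by simpa using h⟩
    · exact ⟨-v, by simpa using hv, by push_cast at h ⊢; rw [← h]; ring⟩
  have hsub : (Finset.univ.filter (fun c : (ZMod q)ˣ => latticeMin (c : ZMod q) = l)) ⊆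
      (Finset.univ.filter (fun c : (ZMod q)ˣ => (c : ZMod q) ∈ A)) ∪
      (Finset.univ.filter (fun c : (ZMod q)ˣ => ((c⁻¹ : (ZMod q)ˣ) : ZMod q) ∈ A)) := by
    intro c hc
    have hc' := (Finset.mem_filter.1 hc).2
    obtain ⟨p, hp, h | h⟩ := exists_shortest (c : ZMod q)
    · rw [hc'] at h
      exact Finset.mem_union_left _ (Finset.mem_filter.2
        ⟨Finset.mem_univ _, key _ _ _ h.1 h.2 hp.symm⟩)
    · rw [hc'] at h
      exact Finset.mem_union_right _ (Finset.mem_filter.2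
        ⟨Finset.mem_univ _, key _ _ _ h.1 h.2 (by rw [hp, ← mul_assoc, Units.inv_mul, one_mul])⟩)
  have h1 : (Finset.univ.filter (fun c : (ZMod q)ˣ => (c : ZMod q) ∈ A)).card ≤ A.card :=
    Finset.card_le_card_of_injOn (fun c => (c : ZMod q)) (fun c hc => by simpa using hc)
      (fun _ _ _ _ h => Units.ext h)
  have h2 : (Finset.univ.filter (fun c : (ZMod q)ˣ => ((c⁻¹ : (ZMod q)ˣ) : ZMod q) ∈ A)).card
      ≤ A.card :=
    Finset.card_le_card_of_injOn (fun c => ((c⁻¹ : (ZMod q)ˣ) : ZMod q))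
      (fun c hc => by simpa using hc) (fun _ _ _ _ h => inv_injective (Units.ext h))
  have h3 : A.card ≤ 6 * l := card_mul_small_le l hl
  have := (Finset.card_le_card hsub).trans (Finset.card_union_le _ _)
  omega

/-- The number of square roots of a unit modulo `q` is at most twice the number of divisors. -/
theorem card_sq_eq_le {q : ℕ} [NeZero q] (c : (ZMod q)ˣ) :
    (Finset.univ.filter (fun g : (ZMod q)ˣ => g ^ 2 = c)).card ≤ 2 * q.divisors.card := by
  classical
  have hq : q ≠ 0 := NeZero.ne q
  rcases (Finset.univ.filter (fun g : (ZMod q)ˣ => g ^ 2 = c)).eq_empty_or_nonempty with h0 | ⟨g0, hg0⟩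
  · simp [h0]
  have hg0' : g0 ^ 2 = c := (Finset.mem_filter.1 hg0).2
  have htwo : (Finset.univ.filter (fun x : ZMod q => 2 * x = 0)).card ≤ 2 := by
    have : (Finset.univ.filter (fun x : ZMod q => 2 * x = 0)) ⊆ {0, ((q / 2 : ℕ) : ZMod q)} := by
      intro x hx
      have hx' : 2 * x = 0 := (Finset.mem_filter.1 hx).2
      have hd : q ∣ 2 * x.val := by
        rw [← ZMod.natCast_eq_zero_iff]; push_cast; simpa using hx'
      obtain ⟨k, hk⟩ := hd
      have hlt : x.val < q := ZMod.val_lt x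
      have hk2 : k < 2 := by
        by_contra hge
        have : q * 2 ≤ q * k := Nat.mul_le_mul_left _ (by omega)
        omega
      rw [Finset.mem_insert, Finset.mem_singleton]
      interval_cases k
      · left; rw [← ZMod.val_eq_zero]; omega
      · right
        rw [show q / 2 = x.val by omega]; simp
    exact (Finset.card_le_card this).trans Finset.card_le_two
  -- For d = g/g0 with d² = 1, put b = gcd(d - 1, q); then d ≡ 1 mod b and d ≡ -1 mod q/b. If a and
  -- a1 share the same b, then (a - 1)(a1 + 1) - (a1 - 1)(a + 1) = 2(a - a1) is divisible by q, so
  -- each fibre of f has at most two elements.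
  set f : (ZMod q)ˣ → ℕ := fun g => Nat.gcd ((g * g0⁻¹ : (ZMod q)ˣ) - 1 : ZMod q).val q with hf
  refine Finset.card_le_mul_card_image_of_maps_to (f := f) (t := q.divisors) ?_ 2 ?_
  · intro g _
    exact Nat.mem_divisors.2 ⟨Nat.gcd_dvd_right _ _, hq⟩
  intro b hb
  rcases (Finset.filter (fun g => f g = b) (Finset.univ.filter (fun g : (ZMod q)ˣ => g ^ 2 = c))).eq_empty_or_nonempty with h0 | ⟨g1, hg1⟩
  · simp [h0]
  have hroot : ∀ g : (ZMod q)ˣ, g ^ 2 = c → f g = b →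
      (b : ℤ) ∣ ((g * g0⁻¹ : (ZMod q)ˣ) : ZMod q).val - 1 ∧
      ((q / b : ℕ) : ℤ) ∣ ((g * g0⁻¹ : (ZMod q)ˣ) : ZMod q).val + 1 := by
    intro g hg hgb
    set d : (ZMod q)ˣ := g * g0⁻¹
    have hd2 : d ^ 2 = 1 := by simp [d, mul_pow, hg, hg0']
    set w : ℕ := ((d : ZMod q) - 1).val with hw
    have hwd : ((w : ℕ) : ZMod q) = d - 1 := by simp [hw]
    have hbq : b ∣ q := hgb ▸ Nat.gcd_dvd_right _ _
    have hbw : b ∣ w := hgb ▸ Nat.gcd_dvd_left _ _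
    have hbpos : 0 < b := Nat.pos_of_dvd_of_pos hbq (Nat.pos_of_ne_zero hq)
    have hcong : (q : ℤ) ∣ (d : ZMod q).val - 1 - w := by
      rw [← ZMod.intCast_zmod_eq_zero_iff_dvd]
      push_cast
      rw [hwd]; simp
    refine ⟨?_, ?_⟩
    · have h1 : (b : ℤ) ∣ w := by exact_mod_cast hbw
      have h2 : (b : ℤ) ∣ q := by exact_mod_cast hbq
      have := (dvd_add (h2.trans hcong) h1)
      simpa using this
    · have hprod : q ∣ w * (w + 2) := by
        rw [← ZMod.natCast_eq_zero_iff]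
        push_cast
        rw [hwd]
        have : ((d : ZMod q)) ^ 2 = 1 := by
          rw [← Units.val_pow_eq_pow_val, hd2, Units.val_one]
        linear_combination this
      have hcop : Nat.Coprime (q / b) (w / b) := by
        have := Nat.coprime_div_gcd_div_gcd (m := w) (n := q) (by rw [← hgb] at hbpos; exact hbpos)
        have hgb' : Nat.gcd w q = b := hgb
        rw [hgb'] at this
        exact this.symm
      have h3 : q / b ∣ (w / b) * (w + 2) := by
        have : b * (q / b) ∣ b * ((w / b) * (w + 2)) := by
          rw [Nat.mul_div_cancel' hbq, ← mul_assoc, Nat.mul_div_cancel' hbw]; exact hprod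
        exact Nat.dvd_of_mul_dvd_mul_left hbpos this
      have h4 : q / b ∣ w + 2 := hcop.dvd_of_dvd_mul_left h3
      have h5 : ((q / b : ℕ) : ℤ) ∣ (w : ℤ) + 2 := by exact_mod_cast h4
      have h6 : ((q / b : ℕ) : ℤ) ∣ q := by exact_mod_cast Nat.div_dvd_of_dvd hbq
      have := dvd_add (h6.trans hcong) h5
      ring_nf at this ⊢
      exact this
  refine le_trans ?_ htwo
  obtain ⟨hg1a, hg1b⟩ := Finset.mem_filter.1 hg1
  have hr1 := hroot g1 (Finset.mem_filter.1 hg1a).2 hg1b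
  refine Finset.card_le_card_of_injOn
    (fun g => ((g * g0⁻¹ : (ZMod q)ˣ) : ZMod q) - ((g1 * g0⁻¹ : (ZMod q)ˣ) : ZMod q)) ?_ ?_
  · intro g hg
    obtain ⟨hga, hgb⟩ := Finset.mem_filter.1 hg
    have hr := hroot g (Finset.mem_filter.1 hga).2 hgb
    set a : ℤ := (((g * g0⁻¹ : (ZMod q)ˣ) : ZMod q).val : ℤ) with ha
    set a1 : ℤ := (((g1 * g0⁻¹ : (ZMod q)ˣ) : ZMod q).val : ℤ) with ha1
    have hbq : b ∣ q := Nat.dvd_of_mem_divisors hb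
    have hdvd : (q : ℤ) ∣ 2 * (a - a1) := by
      obtain ⟨s, hs⟩ := hr.1
      obtain ⟨t, ht⟩ := hr1.2
      obtain ⟨s1, hs1⟩ := hr1.1
      obtain ⟨t', ht'⟩ := hr.2
      have hqb : (q : ℤ) = b * ((q / b : ℕ) : ℤ) := by
        exact_mod_cast (Nat.mul_div_cancel' hbq).symm
      refine ⟨s * t - s1 * t', ?_⟩
      rw [hqb]
      have e : (b : ℤ) * ((q / b : ℕ) : ℤ) * (s * t - s1 * t')
        = (b * s) * (((q / b : ℕ) : ℤ) * t) - (b * s1) * (((q / b : ℕ) : ℤ) * t') := by ring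
      rw [e, ← hs, ← hs1, ← ht, ← ht']
      ring
    rw [← ZMod.intCast_zmod_eq_zero_iff_dvd] at hdvd
    push_cast at hdvd
    simp only [Finset.coe_filter, Finset.mem_univ, true_and, Set.mem_ofPred_eq]
    simpa [ha, ha1] using hdvd
  · intro g _ g' _ h
    exact mul_right_cancel (Units.ext (sub_left_injective h))

/-! ### Averaging over units and counting `k' d² ≡ k d'²` -/

section
variable {q : ℕ} [NeZero q]

theorem sum_latticeMin_le (g : ℕ → ℝ) (hg : ∀ l, 0 ≤ g l) :
    ∑ c : (ZMod q)ˣ, g (latticeMin (c : ZMod q)) ≤ ∑ l ∈ Finset.Icc 1 q, 12 * l * g l := by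
  rw [← Finset.sum_fiberwise_of_maps_to (s := Finset.univ) (t := Finset.Icc 1 q)
    (g := fun c : (ZMod q)ˣ => latticeMin (c : ZMod q))
    (fun c _ => Finset.mem_Icc.2 ⟨latticeMin_pos _, latticeMin_le_modulus _⟩)]
  refine Finset.sum_le_sum (fun l hl => ?_)
  have h1 : ∀ c ∈ Finset.univ.filter (fun c : (ZMod q)ˣ => latticeMin (c : ZMod q) = l),
      g (latticeMin (c : ZMod q)) = g l := fun c hc => by rw [(Finset.mem_filter.1 hc).2]
  rw [Finset.sum_congr rfl h1, Finset.sum_const, nsmul_eq_mul]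
  have h2 := card_latticeMin_eq_le (q := q) l (Finset.mem_Icc.1 hl).1
  have h3 := hg l
  gcongr
  exact_mod_cast h2

theorem sum_comp_sq_le (f : (ZMod q)ˣ → ℝ) (hf : ∀ c, 0 ≤ f c) :
    ∑ g : (ZMod q)ˣ, f (g ^ 2) ≤ 2 * q.divisors.card * ∑ c, f c := by
  classical
  rw [← Finset.sum_fiberwise_of_maps_to (s := Finset.univ) (t := Finset.univ)
    (g := fun g : (ZMod q)ˣ => g ^ 2) (fun c _ => Finset.mem_univ _), Finset.mul_sum]
  refine Finset.sum_le_sum (fun c _ => ?_)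
  have h1 : ∀ g ∈ Finset.univ.filter (fun g : (ZMod q)ˣ => g ^ 2 = c), f (g ^ 2) = f c :=
    fun g hg => by rw [(Finset.mem_filter.1 hg).2]
  rw [Finset.sum_congr rfl h1, Finset.sum_const, nsmul_eq_mul]
  have h3 := hf c
  gcongr
  exact_mod_cast card_sq_eq_le c

/-- The reciprocal of the lattice minimum, cut off at `Y`. -/
noncomputable def invMin (Y : ℕ) (c : (ZMod q)ˣ) : ℝ :=
  if latticeMin (c : ZMod q) ≤ Y then (latticeMin (c : ZMod q) : ℝ)⁻¹ else 0

theorem invMin_nonneg (Y : ℕ) (c : (ZMod q)ˣ) : 0 ≤ invMin Y c := by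
  unfold invMin; split_ifs <;> positivity

theorem card_residuePairs_le_invMin (Y : ℕ) (c : (ZMod q)ˣ) :
    ((residuePairs (c : ZMod q) Y).card : ℝ) ≤ 16 * (Y : ℝ) ^ 2 / q + 4 * Y * invMin Y c := by
  unfold invMin
  split_ifs with h
  · exact card_residuePairs_le h
  · rw [card_residuePairs_eq_zero (not_le.1 h), Nat.cast_zero]; positivity

theorem sum_invMin_le (Y : ℕ) : ∑ c : (ZMod q)ˣ, invMin Y c ≤ 12 * Y := by
  refine (sum_latticeMin_le (fun l => if l ≤ Y then (l : ℝ)⁻¹ else 0)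
    (fun l => by split_ifs <;> positivity)).trans ?_
  calc ∑ l ∈ Finset.Icc 1 q, 12 * (l : ℝ) * (if l ≤ Y then (l : ℝ)⁻¹ else 0)
      = ∑ l ∈ Finset.Icc 1 q, if l ≤ Y then (12 : ℝ) else 0 := by
        refine Finset.sum_congr rfl (fun l hl => ?_)
        have : (l : ℝ) ≠ 0 := by have := (Finset.mem_Icc.1 hl).1; positivity
        split_ifs
        · field_simp
        · simp
    _ = ((Finset.Icc 1 q).filter (· ≤ Y)).card * 12 := by
        rw [← Finset.sum_filter, Finset.sum_const, nsmul_eq_mul]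
    _ ≤ (Finset.Icc 1 Y).card * 12 := by
        gcongr
        intro l hl
        simp only [Finset.mem_filter, Finset.mem_Icc] at hl ⊢
        omega
    _ = 12 * Y := by simp [mul_comm]

/-- The O(l) units of minimum l contribute O(1/l) in total, so the second moment is only a harmonic
sum. This is what makes the cross term in `sum_card_residuePairs_mul_le` logarithmic. -/
theorem sum_invMin_sq_le (Y : ℕ) : ∑ c : (ZMod q)ˣ, invMin Y c ^ 2 ≤ 12 * (1 + Real.log q) := by
  refine (sum_latticeMin_le (fun l => (if l ≤ Y then (l : ℝ)⁻¹ else 0) ^ 2)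
    (fun l => by positivity)).trans ?_
  calc ∑ l ∈ Finset.Icc 1 q, 12 * (l : ℝ) * (if l ≤ Y then (l : ℝ)⁻¹ else 0) ^ 2
      ≤ ∑ l ∈ Finset.Icc 1 q, 12 * (l : ℝ)⁻¹ := by
        refine Finset.sum_le_sum (fun l hl => ?_)
        have : (l : ℝ) ≠ 0 := by have := (Finset.mem_Icc.1 hl).1; positivity
        split_ifs
        · apply le_of_eq; field_simp
        · simp
    _ = 12 * ((harmonic q : ℚ) : ℝ) := by
        rw [← Finset.mul_sum, harmonic_eq_sum_Icc]; push_cast; rfl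
    _ ≤ _ := by gcongr; exact harmonic_le_one_add_log q

/-- Expanding the product of the two lattice bounds gives four terms. Three need only first moments
of the reciprocal minima; the product of minima for g and g² is split by AM–GM, and the sums over g²
are pulled back along squaring at a cost of 2τ(q). -/
theorem sum_card_residuePairs_mul_le (Y K : ℕ) :
    ∑ g : (ZMod q)ˣ, ((residuePairs (g : ZMod q) Y).card : ℝ) *
      (residuePairs ((g ^ 2 : (ZMod q)ˣ) : ZMod q) K).card ≤
    2560 * q.divisors.card * (1 + Real.log q) * ((Y : ℝ) ^ 2 * K ^ 2 / q + Y * K) := by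
  have hq : 0 < q := Nat.pos_of_ne_zero (NeZero.ne q)
  have hq' : (0 : ℝ) < q := by exact_mod_cast hq
  set t : ℝ := (q.divisors.card : ℝ) with ht
  set L : ℝ := 1 + Real.log q with hL
  have ht1 : 1 ≤ t := by
    rw [ht]; exact_mod_cast Finset.card_pos.2 ⟨1, Nat.one_mem_divisors.2 hq.ne'⟩
  have hL1 : 1 ≤ L := by
    have := Real.log_nonneg (x := (q : ℝ)) (by exact_mod_cast hq)
    linarith
  have s1 : ∑ g : (ZMod q)ˣ, invMin Y g ≤ 12 * Y := sum_invMin_le Y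
  have s2 : ∑ g : (ZMod q)ˣ, invMin K (g ^ 2) ≤ 2 * t * (12 * K) :=
    (sum_comp_sq_le _ (invMin_nonneg K)).trans (by gcongr; exact sum_invMin_le K)
  have s3 : ∑ g : (ZMod q)ˣ, invMin Y g * invMin K (g ^ 2) ≤ 18 * t * L := by
    have a1 : ∑ g : (ZMod q)ˣ, invMin Y g ^ 2 ≤ 12 * L := sum_invMin_sq_le Y
    have a2 : ∑ g : (ZMod q)ˣ, invMin K (g ^ 2) ^ 2 ≤ 2 * t * (12 * L) :=
      (sum_comp_sq_le (fun c => invMin K c ^ 2) (fun _ => by positivity)).trans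
        (by gcongr; exact sum_invMin_sq_le K)
    calc ∑ g : (ZMod q)ˣ, invMin Y g * invMin K (g ^ 2)
        ≤ ∑ g : (ZMod q)ˣ, (invMin Y g ^ 2 + invMin K (g ^ 2) ^ 2) / 2 := by
          refine Finset.sum_le_sum (fun g _ => ?_)
          nlinarith [sq_nonneg (invMin Y g - invMin K (g ^ 2))]
      _ = (∑ g : (ZMod q)ˣ, invMin Y g ^ 2 + ∑ g : (ZMod q)ˣ, invMin K (g ^ 2) ^ 2) / 2 := by
          rw [← Finset.sum_div, Finset.sum_add_distrib]
      _ ≤ (12 * L + 2 * t * (12 * L)) / 2 := by gcongr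
      _ ≤ _ := by nlinarith
  have hcard : (Fintype.card (ZMod q)ˣ : ℝ) ≤ q := by
    rw [ZMod.card_units_eq_totient]; exact_mod_cast Nat.totient_le q
  have htL : 1 ≤ t * L := by nlinarith
  have htL2 : t ≤ t * L := by nlinarith
  calc ∑ g : (ZMod q)ˣ, ((residuePairs (g : ZMod q) Y).card : ℝ) *
        (residuePairs ((g ^ 2 : (ZMod q)ˣ) : ZMod q) K).card
      ≤ ∑ g : (ZMod q)ˣ, (16 * (Y : ℝ) ^ 2 / q + 4 * Y * invMin Y g) *
          (16 * (K : ℝ) ^ 2 / q + 4 * K * invMin K (g ^ 2)) := by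
        refine Finset.sum_le_sum (fun g _ => ?_)
        have := invMin_nonneg Y g
        gcongr
        · exact card_residuePairs_le_invMin Y g
        · exact card_residuePairs_le_invMin K _
    _ = Fintype.card (ZMod q)ˣ * (256 * (Y : ℝ) ^ 2 * K ^ 2 / q ^ 2)
        + 64 * (Y : ℝ) ^ 2 / q * K * ∑ g : (ZMod q)ˣ, invMin K (g ^ 2)
        + 64 * (K : ℝ) ^ 2 / q * Y * ∑ g : (ZMod q)ˣ, invMin Y g
        + 16 * Y * K * ∑ g : (ZMod q)ˣ, invMin Y g * invMin K (g ^ 2) := by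
        rw [← nsmul_eq_mul, ← Finset.card_univ, ← Finset.sum_const, Finset.mul_sum, Finset.mul_sum,
          Finset.mul_sum, ← Finset.sum_add_distrib, ← Finset.sum_add_distrib,
          ← Finset.sum_add_distrib]
        refine Finset.sum_congr rfl (fun g _ => ?_)
        field_simp
        ring
    _ ≤ q * (256 * (Y : ℝ) ^ 2 * K ^ 2 / q ^ 2)
        + 64 * (Y : ℝ) ^ 2 / q * K * (2 * t * (12 * K))
        + 64 * (K : ℝ) ^ 2 / q * Y * (12 * Y)
        + 16 * Y * K * (18 * t * L) := by gcongr
    _ = (256 + 1536 * t + 768) * ((Y : ℝ) ^ 2 * K ^ 2 / q) + 288 * (t * L) * (Y * K) := by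
        field_simp
        ring
    _ ≤ (2560 * (t * L)) * ((Y : ℝ) ^ 2 * K ^ 2 / q) + 2560 * (t * L) * (Y * K) := by
        gcongr
        · linarith
        · norm_num
    _ = _ := by ring

/-- Solutions of `k' * d ^ 2 = k * d' ^ 2` modulo `q` in boxes. -/
theorem card_sq_relation_le (Y K : ℕ) (P : Finset (ℕ × ℤ))
    (hP : ∀ p ∈ P, (0 < p.1 ∧ p.1 ≤ Y) ∧ p.1.Coprime q ∧ p.2 ≠ 0 ∧ |p.2| ≤ K) :
    (((P ×ˢ P).filter (fun z => (z.2.2 : ZMod q) * (z.1.1 : ZMod q) ^ 2 =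
      (z.1.2 : ZMod q) * (z.2.1 : ZMod q) ^ 2)).card : ℝ) ≤
    2560 * q.divisors.card * (1 + Real.log q) * ((Y : ℝ) ^ 2 * K ^ 2 / q + Y * K) := by
  classical
  refine le_trans ?_ (sum_card_residuePairs_mul_le Y K)
  have hsub : ((P ×ˢ P).filter (fun z => (z.2.2 : ZMod q) * (z.1.1 : ZMod q) ^ 2 =
      (z.1.2 : ZMod q) * (z.2.1 : ZMod q) ^ 2)).card ≤
      (Finset.univ.biUnion (fun g : (ZMod q)ˣ => residuePairs (g : ZMod q) Y ×ˢ
        residuePairs ((g ^ 2 : (ZMod q)ˣ) : ZMod q) K)).card := by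
    refine Finset.card_le_card_of_injOn
      (fun z => (((z.1.1 : ℤ), (z.2.1 : ℤ)), (z.1.2, z.2.2))) ?_ ?_
    · rintro ⟨⟨d, k⟩, ⟨d', k'⟩⟩ hz
      obtain ⟨hz1, hz2⟩ := Finset.mem_filter.1 hz
      obtain ⟨hz3, hz4⟩ := Finset.mem_product.1 hz1
      obtain ⟨hd, hdc, hk, hkK⟩ := hP _ hz3
      obtain ⟨hd', hdc', hk', hkK'⟩ := hP _ hz4
      dsimp only at hz2 hd hdc hk hkK hd' hdc' hk' hkK'
      set u := ZMod.unitOfCoprime d hdc with hu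
      set u' := ZMod.unitOfCoprime d' hdc' with hu'
      have eu : (d : ZMod q) = u := rfl
      have eu' : (d' : ZMod q) = u' := rfl
      rw [Finset.mem_coe, Finset.mem_biUnion]
      -- The ratio g = d'/d puts (d, d') on the lattice of g; dividing the relation by d² puts (k,
      -- k') on that of g².
      refine ⟨u' * u⁻¹, Finset.mem_univ _, Finset.mem_product.2 ⟨?_, ?_⟩⟩
      · refine mem_residuePairs.2 ⟨?_, ?_, ?_, ?_⟩
        · simpa using hd.2
        · simpa using hd'.2
        · intro h; simp only [Prod.mk_eq_zero] at h; omega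
        · push_cast; rw [eu, eu', mul_assoc, Units.inv_mul, mul_one]
      · refine mem_residuePairs.2 ⟨hkK, hkK', ?_, ?_⟩
        · intro h; exact hk (Prod.mk_eq_zero.1 h).1
        · dsimp only
          rw [eu, eu'] at hz2
          have : ((u : ZMod q) ^ 2) * ((u⁻¹ : (ZMod q)ˣ) : ZMod q) ^ 2 = 1 := by
            rw [← mul_pow, Units.mul_inv, one_pow]
          rw [Units.val_pow_eq_pow_val, Units.val_mul, mul_pow]
          linear_combination ((u⁻¹ : (ZMod q)ˣ) : ZMod q) ^ 2 * hz2 - (k' : ZMod q) * this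
    · rintro ⟨⟨d, k⟩, ⟨d', k'⟩⟩ _ ⟨⟨e, j⟩, ⟨e', j'⟩⟩ _ h
      simp only [Prod.mk.injEq, Nat.cast_inj] at h ⊢
      tauto
  have := hsub.trans Finset.card_biUnion_le
  simp only [Finset.card_product] at this
  exact_mod_cast this

theorem sum_card_fiber_sq {α β : Type*} [Fintype β] [DecidableEq β] (P : Finset α) (f : α → β) :
    ∑ b, ((P.filter (fun p => f p = b)).card : ℝ) ^ 2 =
      ((P ×ˢ P).filter (fun z => f z.1 = f z.2)).card := by
  classical
  rw [Finset.card_eq_sum_card_fiberwise (f := fun z => f z.1) (t := Finset.univ)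
    (fun _ _ => Finset.mem_coe.2 (Finset.mem_univ _)), Nat.cast_sum]
  refine Finset.sum_congr rfl (fun b _ => ?_)
  rw [sq, ← Nat.cast_mul, ← Finset.card_product]
  congr 2
  ext z
  simp only [Finset.mem_product, Finset.mem_filter]
  grind
end

/-! ### Characters and Fourier analysis modulo `q` -/

theorem conj_dirichletCharacter {q : ℕ} {b : ZMod q} (hb : IsUnit b) (χ : DirichletCharacter ℂ q) :
    (starRingEnd ℂ) (χ b) = χ b⁻¹ := by
  have h1 : χ b⁻¹ * χ b = 1 := by
    rw [← map_mul, ZMod.inv_mul_of_unit b hb, map_one]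
  have h2 : ‖χ b‖ = 1 := by
    obtain ⟨u, rfl⟩ := hb
    exact DirichletCharacter.unit_norm_eq_one χ u
  rw [eq_inv_of_mul_eq_one_left h1, Complex.inv_eq_conj h2]

section
variable {q : ℕ} [NeZero q]

theorem norm_stdAddChar_sub_one_ge (k : ZMod q) :
    4 * |(k.valMinAbs : ℝ)| / q ≤ ‖ZMod.stdAddChar k - 1‖ := by
  have hq : (0 : ℝ) < q := by exact_mod_cast Nat.pos_of_ne_zero (NeZero.ne q)
  set v := k.valMinAbs with hv
  have hk : ZMod.stdAddChar k = Complex.exp (Complex.I * ((2 * Real.pi * v / q : ℝ) : ℂ)) := by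
    conv_lhs => rw [← ZMod.coe_valMinAbs k, ZMod.stdAddChar_coe]
    congr 1
    push_cast
    ring
  rw [hk, Complex.norm_exp_I_mul_ofReal_sub_one, norm_mul, Real.norm_eq_abs, Real.norm_eq_abs,
    abs_two]
  have hvq : |(v : ℝ)| ≤ q / 2 := by
    have h1 := ZMod.natAbs_valMinAbs_le k
    have h2 : |(v : ℝ)| = (v.natAbs : ℝ) := by simp
    rw [h2]
    refine le_trans ?_ (Nat.cast_div_le (α := ℝ) (m := q) (n := 2))
    exact_mod_cast h1
  have hx : |2 * Real.pi * v / q / 2| = Real.pi * |(v : ℝ)| / q := by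
    rw [show 2 * Real.pi * (v : ℝ) / q / 2 = Real.pi * v / q by ring, abs_div, abs_mul,
      abs_of_pos Real.pi_pos, abs_of_pos hq]
  have hle : |2 * Real.pi * v / q / 2| ≤ Real.pi / 2 := by
    rw [hx, div_le_iff₀ hq]
    nlinarith [Real.pi_pos]
  have := Real.mul_abs_le_abs_sin hle
  rw [hx] at this
  calc 4 * |(v : ℝ)| / q = 2 * (2 / Real.pi * (Real.pi * |(v : ℝ)| / q)) := by
        field_simp; ring
    _ ≤ _ := by gcongr

/-- Geometric sum bound for additive characters. -/
theorem norm_sum_stdAddChar_le (k : ZMod q) (hk : k ≠ 0) (N : ℕ) :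
    ‖∑ m ∈ Finset.Icc 1 N, ZMod.stdAddChar ((m : ZMod q) * k)‖ ≤ q / |(k.valMinAbs : ℝ)| := by
  have hq : (0 : ℝ) < q := by exact_mod_cast Nat.pos_of_ne_zero (NeZero.ne q)
  have hv : 0 < |(k.valMinAbs : ℝ)| := by
    rw [abs_pos]
    exact_mod_cast fun h => hk (ZMod.valMinAbs_eq_zero _ |>.1 h)
  set z : ℂ := ZMod.stdAddChar k with hz
  have hzm : ∀ m : ℕ, ZMod.stdAddChar ((m : ZMod q) * k) = z ^ m := fun m => by
    rw [← nsmul_eq_mul, AddChar.map_nsmul_eq_pow]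
  have hn : ‖z‖ = 1 := AddChar.norm_apply _ _
  have hsum : (z - 1) * ∑ m ∈ Finset.Icc 1 N, z ^ m = z ^ (N + 1) - z := by
    have h : ∑ m ∈ Finset.Icc 1 N, z ^ m = z * ∑ m ∈ Finset.range N, z ^ m := by
      rw [Finset.mul_sum, Finset.range_eq_Ico, ← Finset.Ico_add_one_right_eq_Icc,
        Finset.sum_Ico_eq_sum_range]
      rw [Finset.range_eq_Ico]
      refine Finset.sum_congr rfl (fun m _ => ?_)
      ring
    rw [h]
    have := mul_geom_sum z N
    linear_combination z * this
  simp_rw [hzm]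
  have h2 : ‖z - 1‖ * ‖∑ m ∈ Finset.Icc 1 N, z ^ m‖ ≤ 2 := by
    rw [← norm_mul, hsum]
    refine (norm_sub_le _ _).trans ?_
    rw [norm_pow, hn]; norm_num
  have h3 := norm_stdAddChar_sub_one_ge k
  rw [← hz] at h3
  have h4 : 4 * |(k.valMinAbs : ℝ)| / q * ‖∑ m ∈ Finset.Icc 1 N, z ^ m‖ ≤ 2 :=
    le_trans (by gcongr) h2
  rw [le_div_iff₀ hv]
  rw [div_mul_eq_mul_div, div_le_iff₀ hq] at h4
  linarith

/-- Parseval's identity on `ZMod q`. -/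
theorem sum_norm_dft_sq (G : ZMod q → ℂ) :
    ∑ k, ‖ZMod.dft G k‖ ^ 2 = q * ∑ a, ‖G a‖ ^ 2 := by
  have hc : ∀ k, (starRingEnd ℂ) (ZMod.dft G k) =
      ∑ j, ZMod.stdAddChar (j * k) * (starRingEnd ℂ) (G j) := fun k => by
    rw [ZMod.dft_apply, map_sum]
    refine Finset.sum_congr rfl (fun j _ => ?_)
    rw [smul_eq_mul, map_mul, ← AddChar.map_neg_eq_conj, neg_neg]
  have hd : ∀ j, ∑ k, ZMod.stdAddChar (j * k) * ZMod.dft G k = q * G j := fun j => by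
    have := congrFun (ZMod.dft_dft G) (-j)
    rw [ZMod.dft_apply] at this
    simp only [smul_eq_mul, neg_neg] at this
    rw [← this]
    refine Finset.sum_congr rfl (fun k _ => ?_)
    rw [mul_neg, neg_neg, mul_comm k j]
  have : (∑ k, ‖ZMod.dft G k‖ ^ 2 : ℂ) = q * ∑ a, (‖G a‖ ^ 2 : ℂ) := by
    simp_rw [← Complex.conj_mul', hc, Finset.sum_mul]
    rw [Finset.sum_comm, Finset.mul_sum]
    refine Finset.sum_congr rfl (fun j _ => ?_)
    rw [← mul_left_comm, ← hd j, Finset.mul_sum]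
    exact Finset.sum_congr rfl (fun k _ => by ring)
  exact_mod_cast this

theorem sum_norm_characters_sq (F : ZMod q → ℂ) :
    ∑ χ : DirichletCharacter ℂ q, ‖∑ a, χ a * F a‖ ^ 2 ≤ q.totient * ∑ a, ‖F a‖ ^ 2 := by
  classical
  have hsum : ∀ a b : ZMod q, (∑ χ : DirichletCharacter ℂ q, (starRingEnd ℂ) (χ b) * χ a) =
      if b = a ∧ IsUnit b then (q.totient : ℂ) else 0 := by
    intro a b
    by_cases hb : IsUnit b
    · simp only [conj_dirichletCharacter hb, hb, and_true]
      exact DirichletCharacter.sum_char_inv_mul_char_eq ℂ hb a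
    · simp [hb, MulChar.map_nonunit]
  have : (∑ χ : DirichletCharacter ℂ q, ‖∑ a, χ a * F a‖ ^ 2 : ℂ) =
      q.totient * ∑ a with IsUnit a, (‖F a‖ ^ 2 : ℂ) := by
    simp_rw [← Complex.conj_mul', map_sum, Finset.sum_mul_sum]
    rw [Finset.sum_comm]
    simp_rw [Finset.sum_comm (s := (Finset.univ : Finset (DirichletCharacter ℂ q)))]
    rw [Finset.mul_sum, Finset.sum_filter]
    refine Finset.sum_congr rfl (fun b _ => ?_)
    calc ∑ a, ∑ χ : DirichletCharacter ℂ q, (starRingEnd ℂ) (χ b * F b) * (χ a * F a)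
        = ∑ a, ((starRingEnd ℂ) (F b) * F a) *
            (if b = a ∧ IsUnit b then (q.totient : ℂ) else 0) := by
          refine Finset.sum_congr rfl (fun a _ => ?_)
          rw [← hsum a b, Finset.mul_sum]
          exact Finset.sum_congr rfl (fun χ _ => by rw [map_mul]; ring)
      _ = _ := by
          by_cases hb : IsUnit b
          · simp [hb, mul_comm]
          · simp [hb]
  have h2 : ∑ χ : DirichletCharacter ℂ q, ‖∑ a, χ a * F a‖ ^ 2 =
      q.totient * ∑ a with IsUnit a, ‖F a‖ ^ 2 := by exact_mod_cast this
  rw [h2]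
  gcongr
  exact Finset.filter_subset _ _

/-- Subtracting the mean of F changes no sum against a non-trivial character. It kills the zero
frequency and leaves the others untouched, so orthogonality followed by Parseval gives the bound. -/
theorem sum_norm_nontrivial_characters_sq_le (F : ZMod q → ℂ) :
    ∑ χ : DirichletCharacter ℂ q with χ ≠ 1, ‖∑ a, χ a * F a‖ ^ 2 ≤
      q.totient * ((1 / q) * ∑ h ∈ Finset.univ.erase (0 : ZMod q), ‖ZMod.dft F h‖ ^ 2) := by
  classical
  have hq : (q : ℂ) ≠ 0 := by exact_mod_cast NeZero.ne q
  have hq' : (q : ℝ) ≠ 0 := by exact_mod_cast NeZero.ne q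
  set c : ℂ := (∑ a, F a) / q with hc
  set G : ZMod q → ℂ := fun a => F a - c with hG
  have h1 : ∀ χ ∈ Finset.univ.filter (fun χ : DirichletCharacter ℂ q => χ ≠ 1),
      ‖∑ a, χ a * F a‖ ^ 2 = ‖∑ a, χ a * G a‖ ^ 2 := by
    intro χ hχ
    have h0 : ∑ a, χ a = 0 := MulChar.sum_eq_zero_of_ne_one (Finset.mem_filter.1 hχ).2
    simp only [hG, mul_sub, Finset.sum_sub_distrib, ← Finset.sum_mul, h0, zero_mul, sub_zero]
  rw [Finset.sum_congr rfl h1]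
  have h2 : ∑ χ : DirichletCharacter ℂ q with χ ≠ 1, ‖∑ a, χ a * G a‖ ^ 2 ≤
      ∑ χ : DirichletCharacter ℂ q, ‖∑ a, χ a * G a‖ ^ 2 :=
    Finset.sum_le_sum_of_subset_of_nonneg (Finset.filter_subset _ _) (fun _ _ _ => by positivity)
  refine (h2.trans (sum_norm_characters_sq G)).trans (le_of_eq ?_)
  congr 1
  have h3 : ∑ a, ‖G a‖ ^ 2 = (1 / q) * ∑ k, ‖ZMod.dft G k‖ ^ 2 := by
    rw [sum_norm_dft_sq]; field_simp
  rw [h3]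
  congr 1
  rw [← Finset.add_sum_erase _ _ (Finset.mem_univ (0 : ZMod q))]
  have h4 : ZMod.dft G 0 = 0 := by
    rw [ZMod.dft_apply_zero]
    simp only [hG, Finset.sum_sub_distrib, Finset.sum_const, Finset.card_univ, ZMod.card, hc,
      nsmul_eq_mul]
    field_simp
    ring
  rw [h4, norm_zero, zero_pow two_ne_zero, zero_add]
  refine Finset.sum_congr rfl (fun h hh => ?_)
  have hh0 : h ≠ 0 := Finset.ne_of_mem_erase hh
  have h5 : ∑ j : ZMod q, ZMod.stdAddChar (-(j * h)) = (0 : ℂ) := by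
    have := AddChar.sum_mulShift (-h) (ZMod.isPrimitive_stdAddChar q)
    rw [if_neg (neg_ne_zero.2 hh0)] at this
    simpa using this
  have h6 : ZMod.dft G h = ZMod.dft F h := by
    simp only [ZMod.dft_apply, hG, smul_eq_mul, mul_sub, Finset.sum_sub_distrib]
    rw [← Finset.sum_mul, h5, zero_mul, sub_zero]
  rw [h6]
end

/-! ### Dyadic levels and elementary inequalities -/

theorem natCast_div_sq_le (X D : ℕ) : ((X / D ^ 2 : ℕ) : ℝ) ≤ X / (D : ℝ) ^ 2 := by
  refine Nat.cast_div_le.trans (le_of_eq ?_)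
  push_cast; rfl

/-- Dyadic majorant of `min M (q / k)`. -/
theorem min_div_le_sum_dyadic (M q k : ℕ) (hM : 0 < M) (hk : 0 < k) (hkq : k ≤ q / 2) (B : ℝ)
    (h1 : B ≤ M) (h2 : B ≤ q / k) :
    B ≤ ∑ j ∈ Finset.range (Nat.log 2 q + 1),
      2 * (q : ℝ) / (2 ^ j * (q / M + 1) : ℕ) * (if k ≤ 2 ^ j * (q / M + 1) then 1 else 0) := by
  set K0 := q / M + 1 with hK0
  have hK0pos : 0 < K0 := Nat.succ_pos _
  have hk' : (0 : ℝ) < k := by exact_mod_cast hk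
  have hlast : k ≤ 2 ^ Nat.log 2 q * K0 := by
    have := Nat.lt_pow_succ_log_self (b := 2) (by norm_num) q
    rw [pow_succ] at this
    have : 2 ^ Nat.log 2 q * 1 ≤ 2 ^ Nat.log 2 q * K0 := Nat.mul_le_mul_left _ (by omega)
    omega
  have hex : ∃ j, k ≤ 2 ^ j * K0 := ⟨_, hlast⟩
  set j := Nat.find hex with hj
  have hjs : k ≤ 2 ^ j * K0 := Nat.find_spec hex
  have hjL : j ≤ Nat.log 2 q := Nat.find_min' hex hlast
  have hterm : B ≤ 2 * (q : ℝ) / (2 ^ j * K0 : ℕ) * (if k ≤ 2 ^ j * K0 then 1 else 0) := by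
    rw [if_pos hjs, mul_one]
    have hpos : (0 : ℝ) < (2 ^ j * K0 : ℕ) := by positivity
    -- At the first admissible level j > 0, minimality gives 2^j K0 ≤ 2k, and the bound q/k applies.
    -- At j = 0 the bound M serves when M ≤ q; otherwise K0 = 1 and q/k ≤ q is enough.
    rcases Nat.eq_zero_or_pos j with h0 | h0
    · rw [h0, pow_zero, one_mul]
      rw [h0, pow_zero, one_mul] at hpos
      rw [le_div_iff₀ hpos]
      have hM' : (0 : ℝ) < M := by exact_mod_cast hM
      rcases le_or_gt M q with hMq | hMq
      · have a1 : K0 * M ≤ 2 * q := by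
          have := Nat.div_mul_le_self q M
          rw [hK0]; nlinarith
        have a2 : (K0 : ℝ) * M ≤ 2 * q := by exact_mod_cast a1
        nlinarith
      · have a1 : K0 = 1 := by rw [hK0, Nat.div_eq_of_lt hMq]
        rw [a1, Nat.cast_one, mul_one]
        have : (q : ℝ) / k ≤ q := div_le_self (by positivity) (by exact_mod_cast hk)
        have : (0 : ℝ) ≤ q := by positivity
        linarith
    · have hmin := Nat.find_min hex (m := j - 1) (by omega)
      have a1 : 2 ^ j * K0 ≤ 2 * k := by
        obtain ⟨i, hi⟩ : ∃ i, j = i + 1 := ⟨j - 1, by omega⟩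
        rw [hi, Nat.add_sub_cancel] at hmin
        rw [hi, pow_succ]
        linarith
      have a2 : ((2 ^ j * K0 : ℕ) : ℝ) ≤ 2 * k := by exact_mod_cast a1
      refine h2.trans ?_
      rw [div_le_div_iff₀ hk' hpos]
      nlinarith [(Nat.cast_nonneg q : (0 : ℝ) ≤ q)]
  refine hterm.trans (Finset.single_le_sum
    (f := fun j => 2 * (q : ℝ) / (2 ^ j * K0 : ℕ) * (if k ≤ 2 ^ j * K0 then 1 else 0))
    (fun i _ => ?_) (Finset.mem_range.2 (Nat.lt_succ_of_le hjL)))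
  split_ifs <;> positivity

/-- The left side is at most qD and at most X/D, hence at most their geometric mean, in which D
cancels. -/
theorem mul_div_succ_le_sqrt (q X D : ℕ) (hD : 0 < D) (hX : 0 < X / D ^ 2) :
    (q : ℝ) * D / (q / (X / D ^ 2) + 1 : ℕ) ≤ √(q * X) := by
  have hD' : (0 : ℝ) < D := by exact_mod_cast hD
  set M := X / D ^ 2 with hM
  have hK1 : (1 : ℝ) ≤ (q / M + 1 : ℕ) := by exact_mod_cast Nat.succ_pos _
  have hlt : (q : ℝ) ≤ M * (q / M + 1 : ℕ) := by exact_mod_cast (Nat.lt_mul_div_succ q hX).le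
  set K : ℝ := ((q / M + 1 : ℕ) : ℝ)
  apply Real.le_sqrt_of_sq_le
  have a1 : q * D / K ≤ (q : ℝ) * D := div_le_self (by positivity) hK1
  have a2 : q * D / K ≤ (X : ℝ) / D := by
    have b1 : (q : ℝ) / K ≤ M := by
      rwa [div_le_iff₀ (by linarith)]
    have b2 := natCast_div_sq_le X D
    rw [← hM] at b2
    calc q * D / K = (q : ℝ) / K * D := by ring
      _ ≤ (X / (D : ℝ) ^ 2) * D := mul_le_mul_of_nonneg_right (b1.trans b2) hD'.le
      _ = _ := by field_simp
  calc (q * D / K : ℝ) ^ 2 = (q * D / K) * (q * D / K) := sq _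
    _ ≤ (q * D) * (X / D) := by gcongr
    _ = _ := by field_simp

/-- The weight (2q/K)² exactly cancels K² in the main term of the second moment, so every dyadic
level costs about the same; the secondary term decreases in K and is worst at the lowest level. -/
theorem level_bound {q K D T S s : ℝ} (hq : 0 < q) (hK : 0 < K) (hT : 0 ≤ T)
    (hS : S ≤ T * ((2 * D) ^ 2 * K ^ 2 / q + 2 * D * K)) (hs : q * D / K ≤ s) :
    (2 * q / K) ^ 2 * S ≤ q * (T * (16 * D ^ 2 + 8 * s)) := by
  calc _ ≤ (2 * q / K) ^ 2 * (T * ((2 * D) ^ 2 * K ^ 2 / q + 2 * D * K)) := by gcongr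
    _ = q * (T * (16 * D ^ 2 + 8 * (q * D / K))) := by field_simp; ring
    _ ≤ _ := by gcongr

theorem sum_sq_le_of_levels {ι : Type*} (s : Finset ι) (g : ι → ℝ) (J : ℕ) (c : ℕ → ℝ)
    (R : ℕ → ι → ℝ) (B : ℝ) (hg : ∀ h ∈ s, 0 ≤ g h)
    (hle : ∀ h ∈ s, g h ≤ ∑ j ∈ Finset.range J, c j * R j h)
    (hR : ∀ j, c j ^ 2 * ∑ h ∈ s, R j h ^ 2 ≤ B) :
    ∑ h ∈ s, g h ^ 2 ≤ (J : ℝ) ^ 2 * B := by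
  calc ∑ h ∈ s, g h ^ 2 ≤ ∑ h ∈ s, (J : ℝ) * ∑ j ∈ Finset.range J, (c j * R j h) ^ 2 := by
        refine Finset.sum_le_sum (fun h hh => ?_)
        refine (pow_le_pow_left₀ (hg h hh) (hle h hh) 2).trans ?_
        have b := sq_sum_le_card_mul_sum_sq (s := Finset.range J) (f := fun j => c j * R j h)
        rwa [Finset.card_range] at b
    _ = J * ∑ j ∈ Finset.range J, c j ^ 2 * ∑ h ∈ s, R j h ^ 2 := by
        rw [← Finset.mul_sum, Finset.sum_comm]
        simp only [mul_pow, Finset.mul_sum]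
    _ ≤ J * ∑ _j ∈ Finset.range J, B := by
        gcongr with j
        exact hR j
    _ = _ := by
        rw [Finset.sum_const, Finset.card_range, nsmul_eq_mul]
        ring

/-! ### The two mean-square bounds for a block -/

section
variable {q : ℕ} [NeZero q]

/-- The weighted number of representations `a = m * d ^ 2` with `d ∈ 𝒟` and `m * d ^ 2 ≤ X`. -/
noncomputable def blockCount (𝒟 : Finset ℕ) (w : ℕ → ℂ) (X : ℕ) (a : ZMod q) : ℂ :=
  ∑ d ∈ 𝒟, ∑ m ∈ Finset.Icc 1 (X / d ^ 2), if (m : ZMod q) * (d : ZMod q) ^ 2 = a then w d else 0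

theorem sum_mul_blockCount (𝒟 : Finset ℕ) (w : ℕ → ℂ) (X : ℕ) (g : ZMod q → ℂ) :
    ∑ a, g a * blockCount 𝒟 w X a =
      ∑ d ∈ 𝒟, w d * ∑ m ∈ Finset.Icc 1 (X / d ^ 2), g ((m : ZMod q) * (d : ZMod q) ^ 2) := by
  simp only [blockCount, Finset.mul_sum]
  rw [Finset.sum_comm]
  refine Finset.sum_congr rfl (fun d _ => ?_)
  rw [Finset.sum_comm]
  refine Finset.sum_congr rfl (fun m _ => ?_)
  simp [mul_comm]

/-- The mean square of `blockCount`, by counting coincidences. -/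
theorem sum_norm_blockCount_sq_le (𝒟 : Finset ℕ) (w : ℕ → ℂ) (hw : ∀ d, ‖w d‖ ≤ 1) (X D : ℕ)
    (hD : 0 < D) (h𝒟 : ∀ d ∈ 𝒟, (D ≤ d ∧ d ≤ 2 * D) ∧ d.Coprime q) :
    ∑ a : ZMod q, ‖blockCount 𝒟 w X a‖ ^ 2 ≤ 2560 * q.divisors.card * (1 + Real.log q) *
      (4 * (X : ℝ) ^ 2 / (D ^ 2 * q) + 2 * X / D) := by
  classical
  set M := X / D ^ 2 with hM
  set P : Finset (ℕ × ℤ) := 𝒟 ×ˢ Finset.Icc (1 : ℤ) M with hP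
  have h1 : ∀ a : ZMod q, ‖blockCount 𝒟 w X a‖ ≤
      (P.filter (fun p => (p.2 : ZMod q) * (p.1 : ZMod q) ^ 2 = a)).card := by
    intro a
    calc ‖blockCount 𝒟 w X a‖ ≤ ∑ d ∈ 𝒟, ∑ m ∈ Finset.Icc 1 (X / d ^ 2),
          (if (m : ZMod q) * (d : ZMod q) ^ 2 = a then (1 : ℝ) else 0) := by
          refine (norm_sum_le _ _).trans (Finset.sum_le_sum (fun d _ => ?_))
          refine (norm_sum_le _ _).trans (Finset.sum_le_sum (fun m _ => ?_))
          split_ifs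
          · exact hw d
          · simp
      _ ≤ ∑ d ∈ 𝒟, ∑ m ∈ Finset.Icc (1 : ℤ) M,
          (if (m : ZMod q) * (d : ZMod q) ^ 2 = a then (1 : ℝ) else 0) := by
          refine Finset.sum_le_sum (fun d hd => ?_)
          have hle : X / d ^ 2 ≤ M :=
            Nat.div_le_div_left (Nat.pow_le_pow_left (h𝒟 d hd).1.1 2) (by positivity)
          calc _ = ∑ m ∈ (Finset.Icc 1 (X / d ^ 2)).map Nat.castEmbedding,
                (if ((m : ℤ) : ZMod q) * (d : ZMod q) ^ 2 = a then (1 : ℝ) else 0) := by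
                rw [Finset.sum_map]; simp
            _ ≤ _ := by
                refine Finset.sum_le_sum_of_subset_of_nonneg ?_
                  (fun _ _ _ => by split_ifs <;> norm_num)
                intro m hm
                obtain ⟨m', hm', rfl⟩ := Finset.mem_map.1 hm
                rw [Finset.mem_Icc] at hm' ⊢
                simp only [Nat.castEmbedding_apply]
                omega
      _ = _ := by
          rw [← Finset.sum_product', ← hP, Finset.card_filter]
          push_cast; rfl
  have hcount : (((P ×ˢ P).filter (fun z => (z.1.2 : ZMod q) * (z.1.1 : ZMod q) ^ 2 =
      (z.2.2 : ZMod q) * (z.2.1 : ZMod q) ^ 2)).card : ℝ) ≤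
      2560 * q.divisors.card * (1 + Real.log q) *
        (((2 * D : ℕ) : ℝ) ^ 2 * M ^ 2 / q + (2 * D : ℕ) * M) := by
    refine le_trans ?_ (card_sq_relation_le (q := q) (2 * D) M P ?_)
    · norm_cast
      -- Exchanging the two d's turns the coincidence m d² = m' d'² into the crossed relation of
      -- `card_sq_relation_le`.
      refine Finset.card_le_card_of_injOn (fun z => ((z.2.1, z.1.2), (z.1.1, z.2.2))) ?_ ?_
      · rintro ⟨⟨d, k⟩, ⟨d', k'⟩⟩ hz
        simp only [Finset.coe_filter, Set.mem_ofPred_eq, Finset.mem_product, hP] at hz ⊢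
        exact ⟨⟨⟨hz.1.2.1, hz.1.1.2⟩, hz.1.1.1, hz.1.2.2⟩, hz.2.symm⟩
      · rintro ⟨⟨d, k⟩, ⟨d', k'⟩⟩ _ ⟨⟨e, j⟩, ⟨e', j'⟩⟩ _ h
        simp only [Prod.mk.injEq] at h ⊢
        tauto
    · intro p hp
      obtain ⟨hp1, hp2⟩ := Finset.mem_product.1 hp
      obtain ⟨⟨a1, a2⟩, a3⟩ := h𝒟 _ hp1
      rw [Finset.mem_Icc] at hp2
      exact ⟨⟨by omega, a2⟩, a3, by omega, by rw [abs_of_nonneg] <;> omega⟩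
  have hlog : 0 ≤ Real.log q := Real.log_natCast_nonneg q
  have hD' : (0 : ℝ) < D := by exact_mod_cast hD
  have hq : (0 : ℝ) < q := by exact_mod_cast Nat.pos_of_ne_zero (NeZero.ne q)
  calc ∑ a : ZMod q, ‖blockCount 𝒟 w X a‖ ^ 2
      ≤ ∑ a : ZMod q, ((P.filter (fun p => (p.2 : ZMod q) * (p.1 : ZMod q) ^ 2 = a)).card : ℝ) ^ 2 :=
        Finset.sum_le_sum (fun a _ => by have := h1 a; gcongr)
    _ = (((P ×ˢ P).filter (fun z => (z.1.2 : ZMod q) * (z.1.1 : ZMod q) ^ 2 =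
          (z.2.2 : ZMod q) * (z.2.1 : ZMod q) ^ 2)).card : ℝ) := by
        exact sum_card_fiber_sq P (fun p => (p.2 : ZMod q) * (p.1 : ZMod q) ^ 2)
    _ ≤ _ := hcount
    _ ≤ 2560 * q.divisors.card * (1 + Real.log q) *
        (((2 * D : ℕ) : ℝ) ^ 2 * (X / (D : ℝ) ^ 2) ^ 2 / q + (2 * D : ℕ) * (X / (D : ℝ) ^ 2)) := by
        have := natCast_div_sq_le X D
        rw [← hM] at this
        gcongr
    _ = _ := by
        push_cast
        field_simp
        ring

/-- Second moment of the number of `d` such that `d ^ 2 * h` is close to zero modulo `q`. -/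
theorem sum_card_small_sq_le (𝒟 : Finset ℕ) (Y K : ℕ)
    (h𝒟 : ∀ d ∈ 𝒟, (0 < d ∧ d ≤ Y) ∧ d.Coprime q) :
    ∑ h ∈ Finset.univ.erase (0 : ZMod q),
      ((𝒟.filter (fun d : ℕ => ((d : ZMod q) ^ 2 * h).valMinAbs.natAbs ≤ K)).card : ℝ) ^ 2 ≤
    2560 * q.divisors.card * (1 + Real.log q) * ((Y : ℝ) ^ 2 * K ^ 2 / q + Y * K) := by
  classical
  -- The frequency is recovered as h = k/d², so the second moment over h counts pairs with equal
  -- ratio. The value k = 0 cannot occur, since h ≠ 0 and d is a unit.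
  set P : Finset (ℕ × ℤ) := 𝒟 ×ˢ (Finset.Icc (-(K : ℤ)) K).erase 0 with hP
  have hinv : ∀ d ∈ 𝒟, (d : ZMod q) ^ 2 * ((d : ZMod q) ^ 2)⁻¹ = 1 := fun d hd =>
    ZMod.mul_inv_of_unit _ (((ZMod.isUnit_iff_coprime d q).2 (h𝒟 d hd).2).pow 2)
  have h1 : ∀ h ∈ Finset.univ.erase (0 : ZMod q),
      (𝒟.filter (fun d : ℕ => ((d : ZMod q) ^ 2 * h).valMinAbs.natAbs ≤ K)).card ≤
      (P.filter (fun p => (p.2 : ZMod q) * ((p.1 : ZMod q) ^ 2)⁻¹ = h)).card := by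
    intro h hh
    have hh0 : h ≠ 0 := Finset.ne_of_mem_erase hh
    refine Finset.card_le_card_of_injOn (fun d => (d, ((d : ZMod q) ^ 2 * h).valMinAbs)) ?_ ?_
    · intro d hd
      obtain ⟨hd1, hd2⟩ := Finset.mem_filter.1 hd
      have hi := hinv d hd1
      refine Finset.mem_coe.2 (Finset.mem_filter.2 ⟨Finset.mem_product.2 ⟨hd1, ?_⟩, ?_⟩)
      · rw [Finset.mem_erase, Finset.mem_Icc]
        refine ⟨fun h0 => hh0 ?_, by dsimp only; omega, by dsimp only; omega⟩
        have := (ZMod.valMinAbs_eq_zero _).1 h0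
        calc h = ((d : ZMod q) ^ 2 * h) * ((d : ZMod q) ^ 2)⁻¹ := by linear_combination (-h) * hi
          _ = 0 := by rw [this, zero_mul]
      · dsimp only
        rw [ZMod.coe_valMinAbs]
        linear_combination h * hi
    · intro d _ d' _ h
      exact (Prod.mk.inj h).1
  have h2 : ∑ h ∈ Finset.univ.erase (0 : ZMod q),
      ((𝒟.filter (fun d : ℕ => ((d : ZMod q) ^ 2 * h).valMinAbs.natAbs ≤ K)).card : ℝ) ^ 2 ≤
      ((P ×ˢ P).filter (fun z => (z.2.2 : ZMod q) * (z.1.1 : ZMod q) ^ 2 =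
        (z.1.2 : ZMod q) * (z.2.1 : ZMod q) ^ 2)).card := by
    calc _ ≤ ∑ h ∈ Finset.univ.erase (0 : ZMod q),
          ((P.filter (fun p => (p.2 : ZMod q) * ((p.1 : ZMod q) ^ 2)⁻¹ = h)).card : ℝ) ^ 2 := by
          refine Finset.sum_le_sum (fun h hh => ?_)
          have := h1 h hh
          gcongr
      _ ≤ ∑ h : ZMod q,
          ((P.filter (fun p => (p.2 : ZMod q) * ((p.1 : ZMod q) ^ 2)⁻¹ = h)).card : ℝ) ^ 2 :=
          Finset.sum_le_sum_of_subset_of_nonneg (Finset.erase_subset _ _)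
            (fun _ _ _ => by positivity)
      _ = _ := sum_card_fiber_sq P (fun p => (p.2 : ZMod q) * ((p.1 : ZMod q) ^ 2)⁻¹)
      _ ≤ _ := by
          refine Nat.cast_le.2 (Finset.card_le_card (fun z hz => ?_))
          obtain ⟨hz1, hz2⟩ := Finset.mem_filter.1 hz
          refine Finset.mem_filter.2 ⟨hz1, ?_⟩
          obtain ⟨hz3, hz4⟩ := Finset.mem_product.1 hz1
          have i1 := hinv _ (Finset.mem_product.1 hz3).1
          have i2 := hinv _ (Finset.mem_product.1 hz4).1
          linear_combination (-(z.1.1 : ZMod q) ^ 2 * (z.2.1 : ZMod q) ^ 2) * hz2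
            + (z.1.2 : ZMod q) * (z.2.1 : ZMod q) ^ 2 * i1
            - (z.2.2 : ZMod q) * (z.1.1 : ZMod q) ^ 2 * i2
  refine h2.trans (card_sq_relation_le (q := q) Y K P ?_)
  intro p hp
  obtain ⟨hp1, hp2⟩ := Finset.mem_product.1 hp
  rw [Finset.mem_erase, Finset.mem_Icc] at hp2
  exact ⟨(h𝒟 _ hp1).1, (h𝒟 _ hp1).2, hp2.1, abs_le.2 hp2.2⟩

/-- For each d the sum over m is a geometric progression with frequency -d²h, bounded both by its
length and by q over the least residue; `min_div_le_sum_dyadic` then trades this minimum for counts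
of small residues. -/
theorem norm_dft_blockCount_le (𝒟 : Finset ℕ) (w : ℕ → ℂ) (hw : ∀ d, ‖w d‖ ≤ 1) (X D : ℕ)
    (hD : 0 < D) (hX : 0 < X / D ^ 2) (h𝒟 : ∀ d ∈ 𝒟, D ≤ d ∧ d.Coprime q) (h : ZMod q)
    (hh : h ≠ 0) :
    ‖ZMod.dft (blockCount (q := q) 𝒟 w X) h‖ ≤ ∑ j ∈ Finset.range (Nat.log 2 q + 1),
      2 * (q : ℝ) / (2 ^ j * (q / (X / D ^ 2) + 1) : ℕ) *
        (𝒟.filter (fun d : ℕ => ((d : ZMod q) ^ 2 * h).valMinAbs.natAbs ≤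
          2 ^ j * (q / (X / D ^ 2) + 1))).card := by
  set M := X / D ^ 2 with hM
  have h1 : ZMod.dft (blockCount (q := q) 𝒟 w X) h = ∑ d ∈ 𝒟, w d *
      ∑ m ∈ Finset.Icc 1 (X / d ^ 2), ZMod.stdAddChar ((m : ZMod q) * (-((d : ZMod q) ^ 2 * h))) := by
    rw [ZMod.dft_apply]
    simp only [smul_eq_mul]
    rw [sum_mul_blockCount 𝒟 w X (fun a => ZMod.stdAddChar (-(a * h)))]
    refine Finset.sum_congr rfl (fun d _ => ?_)
    congr 1
    refine Finset.sum_congr rfl (fun m _ => ?_)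
    congr 1
    ring
  have h2 : ∀ d ∈ 𝒟, ‖w d * ∑ m ∈ Finset.Icc 1 (X / d ^ 2),
      ZMod.stdAddChar ((m : ZMod q) * (-((d : ZMod q) ^ 2 * h)))‖ ≤
      ∑ j ∈ Finset.range (Nat.log 2 q + 1), 2 * (q : ℝ) / (2 ^ j * (q / M + 1) : ℕ) *
        (if ((d : ZMod q) ^ 2 * h).valMinAbs.natAbs ≤ 2 ^ j * (q / M + 1) then 1 else 0) := by
    intro d hd
    have hk0 : (d : ZMod q) ^ 2 * h ≠ 0 := by
      have hu : IsUnit ((d : ZMod q) ^ 2) := ((ZMod.isUnit_iff_coprime d q).2 (h𝒟 d hd).2).pow 2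
      rwa [Ne, hu.mul_right_eq_zero]
    refine min_div_le_sum_dyadic M q _ hX ?_ (ZMod.natAbs_valMinAbs_le _) _ ?_ ?_
    · rw [Int.natAbs_pos]
      exact fun h0 => hk0 ((ZMod.valMinAbs_eq_zero _).1 h0)
    · rw [norm_mul]
      have hle : X / d ^ 2 ≤ M :=
        Nat.div_le_div_left (Nat.pow_le_pow_left (h𝒟 d hd).1 2) (by positivity)
      calc _ ≤ 1 * ∑ m ∈ Finset.Icc 1 (X / d ^ 2), (1 : ℝ) := by
            gcongr
            · exact hw d
            · refine (norm_sum_le _ _).trans (Finset.sum_le_sum (fun m _ => ?_))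
              rw [AddChar.norm_apply]
        _ ≤ M := by simpa using hle
    · rw [norm_mul]
      have := norm_sum_stdAddChar_le (-((d : ZMod q) ^ 2 * h)) (neg_ne_zero.2 hk0) (X / d ^ 2)
      have e : |((-((d : ZMod q) ^ 2 * h)).valMinAbs : ℝ)| =
          (((d : ZMod q) ^ 2 * h).valMinAbs.natAbs : ℝ) := by
        rw [← Int.cast_abs, ← ZMod.natAbs_valMinAbs_neg, Nat.cast_natAbs]
      rw [e] at this
      calc _ ≤ 1 * ‖∑ m ∈ Finset.Icc 1 (X / d ^ 2),
            ZMod.stdAddChar ((m : ZMod q) * (-((d : ZMod q) ^ 2 * h)))‖ := by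
            gcongr; exact hw d
        _ ≤ _ := by rw [one_mul]; exact this
  rw [h1]
  refine (norm_sum_le _ _).trans ((Finset.sum_le_sum h2).trans (le_of_eq ?_))
  rw [Finset.sum_comm]
  refine Finset.sum_congr rfl (fun j _ => ?_)
  rw [← Finset.mul_sum, Finset.card_filter]
  push_cast
  rfl

/-- The variance of `blockCount`, by Fourier analysis modulo `q`. -/
theorem sum_norm_dft_blockCount_sq_le (𝒟 : Finset ℕ) (w : ℕ → ℂ) (hw : ∀ d, ‖w d‖ ≤ 1) (X D : ℕ)
    (hD : 0 < D) (h𝒟 : ∀ d ∈ 𝒟, (D ≤ d ∧ d ≤ 2 * D) ∧ d.Coprime q) :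
    (1 / (q : ℝ)) * ∑ h ∈ Finset.univ.erase (0 : ZMod q), ‖ZMod.dft (blockCount 𝒟 w X) h‖ ^ 2 ≤
    2560 * q.divisors.card * (1 + Real.log q) * (Nat.log 2 q + 1) ^ 2 *
      (16 * (D : ℝ) ^ 2 + 8 * √(q * X)) := by
  have hlog : 0 ≤ Real.log q := Real.log_natCast_nonneg q
  have hD' : (0 : ℝ) < D := by exact_mod_cast hD
  have hq : (0 : ℝ) < q := by exact_mod_cast Nat.pos_of_ne_zero (NeZero.ne q)
  rcases Nat.eq_zero_or_pos (X / D ^ 2) with h0 | hX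
  -- For D² > X no m is available, and the level scheme, which needs a positive length X / D², is
  -- bypassed.
  · have hz : blockCount (q := q) 𝒟 w X = 0 := by
      funext a
      refine Finset.sum_eq_zero (fun d hd => ?_)
      have hle : X / d ^ 2 ≤ X / D ^ 2 :=
        Nat.div_le_div_left (Nat.pow_le_pow_left (h𝒟 d hd).1.1 2) (by positivity)
      rw [Nat.le_zero.1 (hle.trans h0.le)]
      simp
    rw [hz, map_zero]
    simp only [Pi.zero_apply, norm_zero, ne_eq, OfNat.ofNat_ne_zero, not_false_eq_true, zero_pow,
      Finset.sum_const_zero, mul_zero]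
    positivity
  set T : ℝ := 2560 * q.divisors.card * (1 + Real.log q) with hT
  have hT0 : 0 ≤ T := by positivity
  have key := sum_sq_le_of_levels (Finset.univ.erase (0 : ZMod q))
    (fun h => ‖ZMod.dft (blockCount (q := q) 𝒟 w X) h‖) (Nat.log 2 q + 1)
    (fun j => 2 * (q : ℝ) / (2 ^ j * (q / (X / D ^ 2) + 1) : ℕ))
    (fun j h => (𝒟.filter (fun d : ℕ => ((d : ZMod q) ^ 2 * h).valMinAbs.natAbs ≤
      2 ^ j * (q / (X / D ^ 2) + 1))).card)
    (q * (T * (16 * (D : ℝ) ^ 2 + 8 * √(q * X)))) (fun _ _ => norm_nonneg _)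
    (fun h hh => norm_dft_blockCount_le 𝒟 w hw X D hD hX
      (fun d hd => ⟨(h𝒟 d hd).1.1, (h𝒟 d hd).2⟩) h (Finset.ne_of_mem_erase hh))
    (fun j => by
      have hs := sum_card_small_sq_le (q := q) 𝒟 (2 * D) (2 ^ j * (q / (X / D ^ 2) + 1))
        (fun d hd => ⟨⟨hD.trans_le (h𝒟 d hd).1.1, (h𝒟 d hd).1.2⟩, (h𝒟 d hd).2⟩)
      have hqD := mul_div_succ_le_sqrt q X D hD hX
      have hK0 : 0 < q / (X / D ^ 2) + 1 := Nat.succ_pos _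
      generalize q / (X / D ^ 2) + 1 = K0 at hs hqD hK0 ⊢
      have hKge : (K0 : ℝ) ≤ ((2 ^ j * K0 : ℕ) : ℝ) := by
        exact_mod_cast Nat.le_mul_of_pos_left _ (by positivity)
      have hK0' : (0 : ℝ) < K0 := by exact_mod_cast hK0
      rw [← hT, Nat.cast_mul 2 D] at hs
      exact level_bound hq (hK0'.trans_le hKge) hT0 hs
        ((div_le_div_of_nonneg_left (by positivity) hK0' hKge).trans hqD))
  calc _ ≤ (1 / (q : ℝ)) * (((Nat.log 2 q + 1 : ℕ) : ℝ) ^ 2 *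
        (q * (T * (16 * (D : ℝ) ^ 2 + 8 * √(q * X))))) := by gcongr
    _ = _ := by
        push_cast
        field_simp
end

/-! ### Squarefree numbers and assembly of the blocks -/

theorem sq_dvd_sq_mul_squarefree {a b d : ℕ} (ha : Squarefree a) (hb : b ≠ 0) :
    d ^ 2 ∣ b ^ 2 * a ↔ d ∣ b := by
  refine ⟨fun h => ?_, fun h => (pow_dvd_pow_of_dvd h 2).mul_right a⟩
  obtain ⟨g, d', b', hg, hcop, hd, hb'⟩ := Nat.exists_coprime' (Nat.gcd_pos_of_pos_right d (Nat.pos_of_ne_zero hb))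
  have h1 : d' ^ 2 ∣ b' ^ 2 * a := by
    have : g ^ 2 * d' ^ 2 ∣ g ^ 2 * (b' ^ 2 * a) := by
      rw [hd, hb'] at h
      convert h using 1 <;> ring
    exact Nat.dvd_of_mul_dvd_mul_left (by positivity) this
  have h2 : d' ^ 2 ∣ a := (Nat.Coprime.pow 2 2 hcop).dvd_of_dvd_mul_left h1
  have h3 : d' = 1 := Nat.isUnit_iff.1 (ha d' (by rwa [← sq]))
  rw [hd, hb', h3, one_mul]
  exact Dvd.intro_left _ rfl

/-- Write n = b²a with a squarefree. Then d² ∣ n exactly when d ∣ b, so the sum is Σ_{d ∣ b} μ(d),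
which is 1 for b = 1 and 0 otherwise. -/
theorem abs_moebius_eq_sum (X n : ℕ) (hn : 1 ≤ n) (hnX : n ≤ X) :
    |ArithmeticFunction.moebius n| =
      ∑ d ∈ (Finset.Icc 1 X).filter (fun d => d ^ 2 ∣ n), ArithmeticFunction.moebius d := by
  obtain ⟨a, b, hab, ha⟩ := Nat.sq_mul_squarefree n
  have hb : b ≠ 0 := by rintro rfl; simp at hab; omega
  have hbn : b ≤ n := by
    have ha0 : 0 < a := Nat.pos_of_ne_zero ha.ne_zero
    have hb0 : 0 < b := Nat.pos_of_ne_zero hb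
    nlinarith [Nat.mul_le_mul (Nat.mul_le_mul hb0 (le_refl b)) ha0]
  have hset : (Finset.Icc 1 X).filter (fun d => d ^ 2 ∣ n) = b.divisors := by
    ext d
    rw [Finset.mem_filter, Finset.mem_Icc, ← hab, sq_dvd_sq_mul_squarefree ha hb, Nat.mem_divisors]
    refine ⟨fun h => ⟨h.2, hb⟩, fun h => ⟨⟨Nat.pos_of_dvd_of_pos h.1 (Nat.pos_of_ne_zero hb), ?_⟩, h.1⟩⟩
    exact (Nat.le_of_dvd (Nat.pos_of_ne_zero hb) h.1).trans (hbn.trans hnX)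
  have hsq : Squarefree n ↔ b = 1 := by
    refine ⟨fun h => Nat.isUnit_iff.1 (h b ?_), fun h => ?_⟩
    · rw [← hab, sq]; exact Dvd.intro _ rfl
    · rw [← hab, h]; simpa using ha
  rw [hset, ← ArithmeticFunction.coe_zeta_mul_apply, ArithmeticFunction.coe_zeta_mul_moebius,
    ArithmeticFunction.one_apply, ArithmeticFunction.abs_moebius]
  simp only [hsq]

theorem sum_filter_dvd_Icc (X k : ℕ) (hk : 0 < k) (f : ℕ → ℂ) :
    ∑ n ∈ (Finset.Icc 1 X).filter (fun n => k ∣ n), f n =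
      ∑ m ∈ Finset.Icc 1 (X / k), f (m * k) := by
  symm
  refine Finset.sum_bij (fun m _ => m * k) ?_ ?_ ?_ (fun _ _ => rfl)
  · intro m hm
    rw [Finset.mem_Icc] at hm
    rw [Finset.mem_filter, Finset.mem_Icc]
    exact ⟨⟨Nat.mul_pos hm.1 hk, (Nat.le_div_iff_mul_le hk).1 hm.2⟩, Dvd.intro_left _ rfl⟩
  · intro m _ m' _ h
    exact Nat.eq_of_mul_eq_mul_right hk h
  · intro n hn
    rw [Finset.mem_filter, Finset.mem_Icc] at hn
    obtain ⟨⟨h1, h2⟩, m, rfl⟩ := hn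
    refine ⟨m, Finset.mem_Icc.2 ⟨Nat.pos_of_ne_zero ?_, ?_⟩, mul_comm _ _⟩
    · rintro rfl; simp at h1
    · rw [Nat.le_div_iff_mul_le hk, mul_comm]; exact h2

/-- The integers up to `X`, coprime to `q`, in the `i`-th dyadic interval. -/
def dyadicBlock (q X i : ℕ) : Finset ℕ :=
  (Finset.Icc 1 X).filter (fun d => Nat.log 2 d = i ∧ d.Coprime q)

theorem dyadicBlock_bounds {q X i d : ℕ} (hd : d ∈ dyadicBlock q X i) :
    (2 ^ i ≤ d ∧ d ≤ 2 * 2 ^ i) ∧ d.Coprime q := by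
  obtain ⟨h1, h2, h3⟩ := Finset.mem_filter.1 hd
  have hd0 : d ≠ 0 := by have := (Finset.mem_Icc.1 h1).1; omega
  refine ⟨⟨h2 ▸ Nat.pow_log_le_self 2 hd0, ?_⟩, h3⟩
  have := Nat.lt_pow_succ_log_self (b := 2) (by norm_num) d
  rw [h2, pow_succ] at this
  omega

section
variable {q : ℕ} [NeZero q]

/-- The Möbius function with complex values. -/
noncomputable def moebiusC (d : ℕ) : ℂ := (ArithmeticFunction.moebius d : ℤ)

theorem norm_moebiusC_le (d : ℕ) : ‖moebiusC d‖ ≤ 1 := by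
  rw [moebiusC, Complex.norm_intCast]
  exact_mod_cast ArithmeticFunction.abs_moebius_le_one

theorem sum_squarefree_eq_blocks (X : ℕ) (χ : DirichletCharacter ℂ q) :
    ∑ n ∈ Finset.Icc 1 X, ((|ArithmeticFunction.moebius n| : ℤ) : ℂ) * χ (n : ZMod q) =
      ∑ i ∈ Finset.range (Nat.log 2 X + 1),
        ∑ a, χ a * blockCount (dyadicBlock q X i) moebiusC X a := by
  have h1 : ∑ n ∈ Finset.Icc 1 X, ((|ArithmeticFunction.moebius n| : ℤ) : ℂ) * χ (n : ZMod q) =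
      ∑ d ∈ Finset.Icc 1 X, moebiusC d *
        ∑ m ∈ Finset.Icc 1 (X / d ^ 2), χ ((m : ZMod q) * (d : ZMod q) ^ 2) := by
    calc _ = ∑ n ∈ Finset.Icc 1 X, ∑ d ∈ Finset.Icc 1 X,
          (if d ^ 2 ∣ n then moebiusC d * χ (n : ZMod q) else 0) := by
          refine Finset.sum_congr rfl (fun n hn => ?_)
          rw [Finset.mem_Icc] at hn
          rw [abs_moebius_eq_sum X n hn.1 hn.2, Int.cast_sum, Finset.sum_mul, Finset.sum_filter]
          rfl
      _ = _ := by
          rw [Finset.sum_comm]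
          refine Finset.sum_congr rfl (fun d hd => ?_)
          have hd0 : 0 < d ^ 2 := pow_pos (Finset.mem_Icc.1 hd).1 2
          rw [← Finset.sum_filter, sum_filter_dvd_Icc X (d ^ 2) hd0, Finset.mul_sum]
          refine Finset.sum_congr rfl (fun m _ => ?_)
          push_cast; rfl
  rw [h1]
  rw [← Finset.sum_fiberwise_of_maps_to (t := Finset.range (Nat.log 2 X + 1))
    (g := fun d => Nat.log 2 d) (fun d hd => Finset.mem_range.2
      (Nat.lt_succ_of_le (Nat.log_mono_right (Finset.mem_Icc.1 hd).2)))]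
  refine Finset.sum_congr rfl (fun i _ => ?_)
  rw [sum_mul_blockCount, dyadicBlock, ← Finset.filter_filter]
  symm
  -- Restricting the blocks to d coprime to q is free: otherwise χ(m d²) = 0 for every m.
  refine Finset.sum_filter_of_ne (fun d _ hne => ?_)
  by_contra hcop
  apply hne
  have hnu : ¬ IsUnit (d : ZMod q) := fun h => hcop ((ZMod.isUnit_iff_coprime d q).1 h)
  have h0 : χ (d : ZMod q) = 0 := MulChar.map_nonunit χ hnu
  simp [h0]

theorem block_variance_le (x : ℝ) (hx : 1 ≤ x) (i : ℕ) :
    (1 / (q.totient : ℝ)) * ∑ χ : DirichletCharacter ℂ q with χ ≠ 1,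
      ‖∑ a, χ a * blockCount (dyadicBlock q ⌊x⌋₊ i) moebiusC ⌊x⌋₊ a‖ ^ 2 ≤
    2560 * q.divisors.card * (1 + Real.log q) * (Nat.log 2 q + 1) ^ 2 *
      (16 * (√x * √q + x / √q)) := by
  have hq1 : (1 : ℝ) ≤ q := by exact_mod_cast Nat.pos_of_ne_zero (NeZero.ne q)
  have hq : (0 : ℝ) < q := by linarith
  have hφ : (0 : ℝ) < q.totient := by
    exact_mod_cast Nat.totient_pos.2 (Nat.pos_of_ne_zero (NeZero.ne q))
  have hlog : 0 ≤ Real.log q := Real.log_natCast_nonneg q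
  set X := ⌊x⌋₊ with hX
  have hXx : (X : ℝ) ≤ x := Nat.floor_le (by linarith)
  set D : ℕ := 2 ^ i with hDdef
  have hD : 0 < D := by positivity
  have hD' : (0 : ℝ) < D := by exact_mod_cast hD
  have hblock : ∀ d ∈ dyadicBlock q X i, (D ≤ d ∧ d ≤ 2 * D) ∧ d.Coprime q :=
    fun d hd => dyadicBlock_bounds hd
  set T : ℝ := 2560 * q.divisors.card * (1 + Real.log q) with hT
  have hT0 : 0 ≤ T := by positivity
  have hsx : 0 ≤ √x := Real.sqrt_nonneg x
  have hsq : 0 < √(q : ℝ) := Real.sqrt_pos.2 hq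
  have hxx : √x * √x = x := Real.mul_self_sqrt (by linarith)
  have hqq : √(q : ℝ) * √q = q := Real.mul_self_sqrt hq.le
  have hsq1 : 1 ≤ √(q : ℝ) := Real.one_le_sqrt.2 hq1
  rw [one_div, inv_mul_le_iff₀ hφ]
  -- At D² = x/√q the main terms D² (Fourier side) and x²/(D²q) (direct count) balance, both being
  -- x/√q.
  rcases le_or_gt ((D : ℝ) ^ 2) (x / √q) with hcase | hcase
  · refine (sum_norm_nontrivial_characters_sq_le _).trans ?_
    refine mul_le_mul_of_nonneg_left ?_ hφ.le
    refine (sum_norm_dft_blockCount_sq_le _ moebiusC norm_moebiusC_le X D hD hblock).trans ?_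
    rw [← hT]
    have hs : √((q : ℝ) * X) ≤ √x * √q := by
      rw [mul_comm, ← Real.sqrt_mul (by linarith)]
      exact Real.sqrt_le_sqrt (by gcongr)
    have : 0 ≤ √x * √q := by positivity
    refine mul_le_mul_of_nonneg_left ?_ (by positivity)
    linarith
  · have h1 : ∑ χ : DirichletCharacter ℂ q with χ ≠ 1,
        ‖∑ a, χ a * blockCount (dyadicBlock q X i) moebiusC X a‖ ^ 2 ≤
        ∑ χ : DirichletCharacter ℂ q,
          ‖∑ a, χ a * blockCount (dyadicBlock q X i) moebiusC X a‖ ^ 2 :=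
      Finset.sum_le_sum_of_subset_of_nonneg (Finset.filter_subset _ _) (fun _ _ _ => by positivity)
    refine (h1.trans (sum_norm_characters_sq _)).trans ?_
    refine mul_le_mul_of_nonneg_left ?_ hφ.le
    refine (sum_norm_blockCount_sq_le _ moebiusC norm_moebiusC_le X D hD hblock).trans ?_
    rw [← hT]
    have hDq : x < (D : ℝ) ^ 2 * √q := by rwa [div_lt_iff₀ hsq] at hcase
    have hx0 : (0 : ℝ) ≤ x := by linarith
    have a1 : 4 * (X : ℝ) ^ 2 / (D ^ 2 * q) ≤ 4 * (x / √q) := by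
      calc 4 * (X : ℝ) ^ 2 / (D ^ 2 * q) ≤ 4 * x ^ 2 / (D ^ 2 * q) := by gcongr
        _ ≤ 4 * (x / √q) := by
            rw [← mul_div_assoc, div_le_div_iff₀ (by positivity) hsq]
            calc 4 * x ^ 2 * √q = 4 * x * (√q * x) := by ring
              _ ≤ 4 * x * (√q * ((D : ℝ) ^ 2 * √q)) := by gcongr
              _ = 4 * x * (D ^ 2 * (√q * √q)) := by ring
              _ = _ := by rw [hqq]
    have a2 : 2 * (X : ℝ) / D ≤ 2 * (√x * √q) := by
      have b1 : √x ≤ D * √q := by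
        apply Real.sqrt_le_iff.2 ⟨by positivity, ?_⟩
        rw [mul_pow, Real.sq_sqrt hq.le]
        refine hDq.le.trans ?_
        have : √(q : ℝ) ≤ q := by nlinarith
        gcongr
      rw [div_le_iff₀ hD']
      calc 2 * (X : ℝ) ≤ 2 * (√x * √x) := by rw [hxx]; gcongr
        _ ≤ 2 * (√x * (D * √q)) := by gcongr
        _ = _ := by ring
    have hJ : (1 : ℝ) ≤ ((Nat.log 2 q : ℝ) + 1) ^ 2 :=
      one_le_pow₀ (by linarith [(Nat.cast_nonneg (Nat.log 2 q) : (0 : ℝ) ≤ (Nat.log 2 q : ℝ))])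
    have hB : 0 ≤ √x * √q := by positivity
    have hB2 : 0 ≤ x / √q := by positivity
    calc T * (4 * (X : ℝ) ^ 2 / (D ^ 2 * q) + 2 * X / D)
        ≤ T * 1 * (16 * (√x * √q + x / √q)) := by
          rw [mul_one]
          exact mul_le_mul_of_nonneg_left (by linarith) hT0
      _ ≤ _ := by gcongr

theorem variance_squarefree_le (x : ℝ) (hx : 1 ≤ x) :
    (1 / (q.totient : ℝ)) * ∑ χ : DirichletCharacter ℂ q with χ ≠ 1,
      ‖∑ n ∈ Finset.Icc 1 ⌊x⌋₊, ((|ArithmeticFunction.moebius n| : ℤ) : ℂ) * χ (n : ZMod q)‖ ^ 2 ≤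
    ((Nat.log 2 ⌊x⌋₊ : ℝ) + 1) ^ 2 * (2560 * q.divisors.card * (1 + Real.log q) *
      (Nat.log 2 q + 1) ^ 2 * (16 * (√x * √q + x / √q))) := by
  set L := Nat.log 2 ⌊x⌋₊ + 1 with hL
  set B : ℝ := 2560 * q.divisors.card * (1 + Real.log q) *
      (Nat.log 2 q + 1) ^ 2 * (16 * (√x * √q + x / √q)) with hB
  calc _ ≤ (1 / (q.totient : ℝ)) * ∑ χ : DirichletCharacter ℂ q with χ ≠ 1,
        (L : ℝ) * ∑ i ∈ Finset.range L,
          ‖∑ a, χ a * blockCount (dyadicBlock q ⌊x⌋₊ i) moebiusC ⌊x⌋₊ a‖ ^ 2 := by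
        gcongr with χ _
        rw [sum_squarefree_eq_blocks]
        refine (pow_le_pow_left₀ (norm_nonneg _) (norm_sum_le _ _) 2).trans ?_
        have b := sq_sum_le_card_mul_sum_sq (s := Finset.range L)
          (f := fun i => ‖∑ a, χ a * blockCount (dyadicBlock q ⌊x⌋₊ i) moebiusC ⌊x⌋₊ a‖)
        rwa [Finset.card_range] at b
    _ = L * ∑ i ∈ Finset.range L, (1 / (q.totient : ℝ)) *
          ∑ χ : DirichletCharacter ℂ q with χ ≠ 1,
            ‖∑ a, χ a * blockCount (dyadicBlock q ⌊x⌋₊ i) moebiusC ⌊x⌋₊ a‖ ^ 2 := by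
        rw [← Finset.mul_sum, Finset.sum_comm, ← Finset.mul_sum]
        ring
    _ ≤ L * ∑ _i ∈ Finset.range L, B := by
        gcongr with i _
        exact block_variance_le x hx i
    _ = _ := by
        rw [Finset.sum_const, Finset.card_range, nsmul_eq_mul, hL]
        push_cast
        ring
end

/-! ### Absorbing divisors and logarithms into `x ^ ε` -/

theorem natLog_two_add_one_le {x : ℝ} (hx : 1 ≤ x) {n : ℕ} (hn : n ≠ 0) (hnx : (n : ℝ) ≤ x) :
    (Nat.log 2 n : ℝ) + 1 ≤ 2 * (1 + Real.log x) := by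
  have h1 : ((2 : ℝ) ^ Nat.log 2 n) ≤ x :=
    le_trans (by exact_mod_cast Nat.pow_log_le_self 2 hn) hnx
  have h2 := Real.log_le_log (by positivity) h1
  rw [Real.log_pow] at h2
  have h3 := Real.log_two_gt_d9
  have h4 := Real.log_nonneg hx
  have h5 : (0 : ℝ) ≤ Nat.log 2 n := Nat.cast_nonneg _
  nlinarith

theorem one_add_log_le {x ε : ℝ} (hx : 1 ≤ x) (hε : 0 < ε) :
    1 + Real.log x ≤ (1 + 1 / ε) * x ^ ε := by
  have h1 := Real.log_le_rpow_div (by linarith : 0 ≤ x) hε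
  have h2 := Real.one_le_rpow hx hε.le
  calc 1 + Real.log x ≤ x ^ ε + x ^ ε / ε := add_le_add h2 h1
    _ = _ := by ring

theorem corollary1 (ε : ℝ) (hε : 0 < ε) :
    ∃ C : ℝ, 0 < C ∧ ∀ (x : ℝ) (q : ℕ) [NeZero q], 1 ≤ x → (q : ℝ) ≤ x →
      (1 / (Nat.totient q : ℝ)) *
          ∑ χ : DirichletCharacter ℂ q with χ ≠ 1,
            ‖∑ n ∈ Finset.Icc 1 ⌊x⌋₊,
              ((|ArithmeticFunction.moebius n| : ℤ) : ℂ) * χ (n : ZMod q)‖ ^ 2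
        ≤ C * x ^ ε * (x ^ (1 / 2 : ℝ) * (q : ℝ) ^ (1 / 2 : ℝ) + x / (q : ℝ) ^ (1 / 2 : ℝ)) := by
  -- Six factors must be absorbed: the divisor function, log q once, and two squared logarithms,
  -- from the blocks and from the Fourier levels. Each gets x^(ε/6); q ≤ x enters only here.
  obtain ⟨C₁, hC₁, hdiv⟩ := card_divisors_le_rpow (ε / 6) (by positivity)
  set c : ℝ := 1 + 1 / (ε / 6) with hc
  have hc0 : 0 < c := by positivity
  refine ⟨16 * 16 * 2560 * C₁ * c ^ 5, by positivity, fun x q _ hx hqx => ?_⟩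
  have hq0 : q ≠ 0 := NeZero.ne q
  have hq1 : (1 : ℝ) ≤ q := by exact_mod_cast Nat.pos_of_ne_zero hq0
  rw [← Real.sqrt_eq_rpow, ← Real.sqrt_eq_rpow]
  refine (variance_squarefree_le x hx).trans ?_
  set y : ℝ := x ^ (ε / 6) with hy
  have hy0 : 0 ≤ y := by positivity
  have hl : 1 + Real.log x ≤ c * y := one_add_log_le hx (by positivity)
  have h1 : (Nat.log 2 ⌊x⌋₊ : ℝ) + 1 ≤ 2 * (c * y) :=
    (natLog_two_add_one_le hx (Nat.floor_pos.2 hx).ne' (Nat.floor_le (by linarith))).trans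
      (by gcongr)
  have h2 : (Nat.log 2 q : ℝ) + 1 ≤ 2 * (c * y) :=
    (natLog_two_add_one_le hx hq0 hqx).trans (by gcongr)
  have h3 : 1 + Real.log q ≤ c * y := by
    refine le_trans ?_ hl
    gcongr
  have h4 : (q.divisors.card : ℝ) ≤ C₁ * y :=
    (hdiv q hq0).trans (by rw [hy]; gcongr)
  have hy6 : y ^ 6 = x ^ ε := by
    rw [hy, ← Real.rpow_natCast, ← Real.rpow_mul (by linarith)]
    congr 1
    push_cast
    ring
  have hlog : 0 ≤ 1 + Real.log q := by linarith [Real.log_natCast_nonneg q]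
  have hB : 0 ≤ √x * √q + x / √q := by positivity
  calc _ ≤ (2 * (c * y)) ^ 2 * (2560 * (C₁ * y) * (c * y) * (2 * (c * y)) ^ 2 *
        (16 * (√x * √q + x / √q))) := by gcongr
    _ = 16 * 16 * 2560 * C₁ * c ^ 5 * y ^ 6 * (√x * √q + x / √q) := by ring
    _ = _ := by rw [hy6]
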